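/- Let $J:\mathbb Z^d\to[0,\infty)$ be invariant under permutations and sign changes of the coordinates, put $J_{x,y}=J(y-x)$, and let $\beta\ge 0$. For a finite $\Lambda\subset\mathbb Z^d$ let $$\langle\varphi_x\varphi_y\rangle_{\beta,\Lambda}=\frac{\sum_{\varphi\in\{\pm1\}^\Lambda}\varphi_x\varphi_y\,e^{-\beta H_\Lambda(\varphi)}}{\sum_{\varphi\in\{\pm1\}^\Lambda}e^{-\beta H_\Lambda(\varphi)}},\qquad H_\Lambda(\varphi)=-\sum_{\{u,v\}\subset\Lambda,\ u\ne v}J_{u,v}\varphi_u\varphi_v,$$ be the Ising two-point function, and let $G(x)=\lim_{\Lambda\uparrow\mathbb Z^d}\langle\varphi_o\varphi_x\rangle_{\beta,\Lambda}$, where $o$ is the origin. Let $\mathbb B_\Lambda$ be the set of pairs $\{u,v\}\subset\Lambda$, $u\ne v$, with $J_{u,v}>0$. For $n\in\mathbb Z_+^{\mathbb B_\Lambda}$ let $\partial n=\{v:\sum_{b\ni v}n_b\text{ is odd}\}$ and $w(n)=\prod_{b\in\mathbb B_\Lambda}(\beta J_b)^{n_b}/n_b!$, and let $Z=\sum_{\partial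 n=\varnothing}w(n)$. The zeroth-order lace-expansion coefficient is $$\pi^{(0)}_{\mathbb B_\Lambda}(x)=\sum_{n:\ \partial n=\{o\}\triangle\{x\}}\frac{w(n)}{Z}\,\mathbf 1\{o\Leftrightarrow_n x\},$$ where $o\Leftrightarrow_n x$ means that $o=x$ or there are two bond-disjoint paths from $o$ to $x$ consisting of bonds $b$ with $n_b>0$. Let $*$ denote convolution on $\mathbb Z^d$, $f^{*j}$ the $j$-fold convolution of $f$ with itself (with $f^{*0}=\delta$, the Kronecker delta at $o$), $\tau(x)=\tanh(\beta J(x))$, $\tilde G=\tau*G$, and, for $m\ge1$, $$U^m(y,z;y',z')=\tilde G(z'-y)\,G(z'-y')\Big((\delta+\tau^2)*\sum_{j=0}^m(\tilde G^2)^{*j}*(\delta+\tau^2)\Big)(y'-z),$$ $$V^m(y,z;x)=\tilde G(x-y)\sum_{j=1}^m(\tilde G^2)^{*j}(x-z),$$ $$X^m_{o,x}=\sum_{i=0}^\infty\ \sum_{\substack{u_0,\dots,u_i\in\mathbb Z^d,\ v_0,\dots,v_i\in\mathbb Z^d\\ u_0=v_0=o}}\ \prod_{j=1}^iU^m(u_{j-1},v_{j-1};u_j,v_j)\;V^m(u_i,v_i;x),$$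 all sums of nonnegative terms being taken in $[0,\infty]$. Then, for every finite $\Lambda\subset\mathbb Z^d$ containing $o$ and every $x\in\Lambda$ with $x\ne o$, $$\pi^{(0)}_{\mathbb B_\Lambda}(x)\le 2X^1_{o,x}.$$ -/

import Mathlib

open Filter Topology
open scoped ENNReal

namespace IsingLace

/-- The `d`-dimensional integer lattice. -/
abbrev Site (d : ℕ) : Type := Fin d → ℤ

/-- A ferromagnetic coupling function `J : ℤᵈ → [0,∞)` that is invariant under the symmetries of
the lattice (permutations and sign changes of the coordinates). -/
structure Coupling (d : ℕ) where
  /-- the function `J` -/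
  J : Site d → ℝ
  nonneg : ∀ x, 0 ≤ J x
  symm : ∀ (σ : Equiv.Perm (Fin d)) (ε : Fin d → ℤˣ) (x : Site d),
    J (fun i => (ε i : ℤ) * x (σ i)) = J x

theorem Coupling.even {d : ℕ} (C : Coupling d) (x : Site d) : C.J (-x) = C.J x := by
  have h := C.symm 1 (fun _ => -1) x
  rw [← h]
  congr 1
  funext i
  simp

/-- The translation-invariant spin-spin coupling `J_{x,y} = J(y - x)` of an unordered pair. -/
def Coupling.pair {d : ℕ} (C : Coupling d) : Sym2 (Site d) → ℝ :=
  Sym2.lift ⟨fun x y => C.J (y - x), fun x y => by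
    show C.J (y - x) = C.J (x - y)
    rw [← C.even (y - x), neg_sub]⟩

/-! ### The Ising model -/

/-- The value at `v` of the spin configuration `φ ∈ {±1}^Λ` (only used for `v ∈ Λ`;
it is set to `0` elsewhere). -/
noncomputable def spin {d : ℕ} {Λ : Finset (Site d)} (φ : Λ → ℤˣ) (v : Site d) : ℝ :=
  if h : v ∈ Λ then (((φ ⟨v, h⟩ : ℤˣ) : ℤ) : ℝ) else 0

open Classical in
/-- The Hamiltonian `H_Λ(φ) = - ∑_{{x,y} ⊂ Λ} J_{x,y} φ_x φ_y`, a sum over unordered pairs of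
distinct vertices. -/
noncomputable def hamiltonian {d : ℕ} (C : Coupling d) (Λ : Finset (Site d)) (φ : Λ → ℤˣ) : ℝ :=
  -∑ b ∈ Λ.sym2 with ¬ b.IsDiag, C.pair b * (b.map (spin φ)).mul

/-- The finite-volume two-point function `⟨φ_x φ_y⟩_{β,Λ}`. -/
noncomputable def twoPoint {d : ℕ} (C : Coupling d) (β : ℝ) (Λ : Finset (Site d))
    (x y : Site d) : ℝ :=
  (∑ φ : Λ → ℤˣ, spin φ x * spin φ y * Real.exp (-β * hamiltonian C Λ φ)) /
    ∑ φ : Λ → ℤˣ, Real.exp (-β * hamiltonian C Λ φ)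

/-- The infinite-volume two-point function `G_β(x) = lim_{Λ ↑ ℤᵈ} ⟨φ_o φ_x⟩_{β,Λ}`, the limit
being taken along the directed set of finite volumes. -/
noncomputable def G {d : ℕ} (C : Coupling d) (β : ℝ) (x : Site d) : ℝ :=
  limUnder atTop (fun Λ : Finset (Site d) => twoPoint C β Λ 0 x)

/-! ### Random currents and the zeroth lace-expansion coefficient -/

open Classical in
/-- The bond set `𝔹_Λ` of pairs of distinct vertices of `Λ` with positive coupling. -/
noncomputable def bonds {d : ℕ} (C : Coupling d) (Λ : Finset (Site d)) :
    Finset (Sym2 (Site d)) :=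
  Λ.sym2.filter (fun b => ¬ b.IsDiag ∧ 0 < C.pair b)

open Classical in
/-- The source set `∂n` of a current configuration on `B`: the vertices `v` at which
`∑_{b ∋ v} n_b` is odd. -/
noncomputable def sources {d : ℕ} {B : Finset (Sym2 (Site d))} (n : B → ℕ) : Set (Site d) :=
  {v | Odd (∑ b : B, if v ∈ (b : Sym2 (Site d)) then n b else 0)}

/-- The weight `w_B(n) = ∏_{b ∈ B} (β J_b)^{n_b} / n_b!`. -/
noncomputable def weight {d : ℕ} (C : Coupling d) (β : ℝ) {B : Finset (Sym2 (Site d))}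
    (n : B → ℕ) : ℝ≥0∞ :=
  ∏ b : B, ENNReal.ofReal ((β * C.pair b) ^ n b / (n b).factorial)

open Classical in
/-- `Z_B`, the sum of the weights of the sourceless current configurations on `B`. -/
noncomputable def Z {d : ℕ} (C : Coupling d) (β : ℝ) (B : Finset (Sym2 (Site d))) : ℝ≥0∞ :=
  ∑' n : B → ℕ, if sources n = ∅ then weight C β n else 0

/-- The graph of the bonds that carry positive current. -/
def currentGraph {d : ℕ} {B : Finset (Sym2 (Site d))} (n : B → ℕ) : SimpleGraph (Site d) where
  Adj u v := u ≠ v ∧ ∃ h : s(u, v) ∈ B, 0 < n ⟨s(u, v), h⟩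
  symm := ⟨fun u v ⟨hne, h, hn⟩ => by
    refine ⟨hne.symm, ?_⟩
    rw [Sym2.eq_swap]
    exact ⟨h, hn⟩⟩
  loopless := ⟨fun _ h => h.1 rfl⟩

/-- `x` and `y` are doubly connected by `n`: either `x = y` or there are two bond-disjoint paths
from `x` to `y` consisting of bonds with positive current. -/
def DoublyConnected {d : ℕ} {B : Finset (Sym2 (Site d))} (n : B → ℕ) (x y : Site d) : Prop :=
  x = y ∨ ∃ p q : (currentGraph n).Walk x y,
    p.IsPath ∧ q.IsPath ∧ List.Disjoint p.edges q.edges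

open Classical in
/-- The zeroth-order lace-expansion coefficient on the bond set `B`. -/
noncomputable def pi0 {d : ℕ} (C : Coupling d) (β : ℝ) (B : Finset (Sym2 (Site d)))
    (x : Site d) : ℝ≥0∞ :=
  ∑' n : B → ℕ,
    if sources n = symmDiff {0} {x} ∧ DoublyConnected n 0 x then weight C β n / Z C β B else 0

/-! ### Diagrams, with values in `[0,∞]` -/

/-- Convolution on the lattice. -/
noncomputable def conv {d : ℕ} (f g : Site d → ℝ≥0∞) (x : Site d) : ℝ≥0∞ :=
  ∑' y, f y * g (x - y)

open Classical in
/-- The Kronecker delta at the origin. -/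
noncomputable def delta {d : ℕ} (x : Site d) : ℝ≥0∞ := if x = 0 then 1 else 0

/-- The `j`-fold convolution of `f` with itself; `δ` for `j = 0`. -/
noncomputable def convPow {d : ℕ} (f : Site d → ℝ≥0∞) : ℕ → Site d → ℝ≥0∞
  | 0 => delta
  | j + 1 => conv f (convPow f j)

/-- `G` as a function with values in `[0,∞]`. -/
noncomputable def GE {d : ℕ} (C : Coupling d) (β : ℝ) (x : Site d) : ℝ≥0∞ :=
  ENNReal.ofReal (G C β x)

/-- `τ(x) = tanh (β J(x))`. -/
noncomputable def tau {d : ℕ} (C : Coupling d) (β : ℝ) (x : Site d) : ℝ≥0∞ :=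
  ENNReal.ofReal (Real.tanh (β * C.J x))

/-- `G̃ = τ * G`. -/
noncomputable def Gt {d : ℕ} (C : Coupling d) (β : ℝ) : Site d → ℝ≥0∞ :=
  conv (tau C β) (GE C β)

/-- `δ + τ²`. -/
noncomputable def dot {d : ℕ} (C : Coupling d) (β : ℝ) (x : Site d) : ℝ≥0∞ :=
  delta x + tau C β x ^ 2

/-- `∑_{j=a}^m (G̃²)^{*j}`. -/
noncomputable def chain {d : ℕ} (C : Coupling d) (β : ℝ) (a m : ℕ) (x : Site d) : ℝ≥0∞ :=
  ∑ j ∈ Finset.Icc a m, convPow (fun w => Gt C β w ^ 2) j x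

/-- `U^m(y,z;y',z')`. -/
noncomputable def U {d : ℕ} (C : Coupling d) (β : ℝ) (m : ℕ) (y z y' z' : Site d) : ℝ≥0∞ :=
  Gt C β (z' - y) * GE C β (z' - y') *
    (if m = 0 then GE C β (y' - z) ^ 2
      else conv (conv (dot C β) (chain C β 0 m)) (dot C β) (y' - z))

/-- `V^m(y,z;x)`. -/
noncomputable def V {d : ℕ} (C : Coupling d) (β : ℝ) (m : ℕ) (y z x : Site d) : ℝ≥0∞ :=
  Gt C β (x - y) * chain C β 1 m (x - z)

open Classical in
/-- The `i`-th term `((U^m)^{⋆i} ⋆ V^m)_{o,x}`: the sum over `u_0,…,u_i` and `v_0,…,v_i` with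
`u_0 = v_0 = o` of `∏_{j=1}^i U^m(u_{j-1},v_{j-1};u_j,v_j) V^m(u_i,v_i;x)`. -/
noncomputable def Xterm {d : ℕ} (C : Coupling d) (β : ℝ) (m i : ℕ) (x : Site d) : ℝ≥0∞ :=
  ∑' (u : Fin (i + 1) → Site d) (v : Fin (i + 1) → Site d),
    if u 0 = 0 ∧ v 0 = 0 then
      (∏ j : Fin i, U C β m (u j.castSucc) (v j.castSucc) (u j.succ) (v j.succ)) *
        V C β m (u (Fin.last i)) (v (Fin.last i)) x
    else 0

/-- `X^m_{o,x} = ∑_{i ≥ 0} ((U^m)^{⋆i} ⋆ V^m)_{o,x}`. -/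
noncomputable def X {d : ℕ} (C : Coupling d) (β : ℝ) (m : ℕ) (x : Site d) : ℝ≥0∞ :=
  ∑' i : ℕ, Xterm C β m i x

end IsingLace

set_option linter.unusedSectionVars false

namespace RandomCurrent

variable {V : Type*} [DecidableEq V]

/-- The boundary modulo two of a single edge. -/
def bd : Sym2 V → V → ZMod 2 :=
  Sym2.lift ⟨fun u v => Pi.single u 1 + Pi.single v 1, fun _ _ => add_comm _ _⟩

theorem add_self_eq_zero (D : V → ZMod 2) : D + D = 0 := by
  funext v; exact CharTwo.add_self_eq_zero (D v)

theorem bd_mk (u v : V) : bd s(u, v) = Pi.single u 1 + Pi.single v 1 := rfl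

/-- The boundary modulo two of a finite set of edges. -/
def bdry (O : Finset (Sym2 V)) : V → ZMod 2 := ∑ e ∈ O, bd e

@[simp] theorem bdry_empty : bdry (∅ : Finset (Sym2 V)) = 0 := rfl

theorem bdry_insert {e : Sym2 V} {O : Finset (Sym2 V)} (h : e ∉ O) :
    bdry (insert e O) = bd e + bdry O := Finset.sum_insert h

theorem bdry_union {O P : Finset (Sym2 V)} (h : Disjoint O P) :
    bdry (O ∪ P) = bdry O + bdry P := Finset.sum_union h

theorem bdry_symmDiff (O P : Finset (Sym2 V)) : bdry (symmDiff O P) = bdry O + bdry P := by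
  have h1 : bdry O = bdry (O \ P) + bdry (O ∩ P) := by
    rw [← bdry_union (Finset.disjoint_sdiff_inter O P), Finset.sdiff_union_inter]
  have h2 : bdry P = bdry (P \ O) + bdry (O ∩ P) := by
    rw [Finset.inter_comm, ← bdry_union (Finset.disjoint_sdiff_inter P O),
      Finset.sdiff_union_inter]
  have h3 : bdry (symmDiff O P) = bdry (O \ P) + bdry (P \ O) :=
    bdry_union disjoint_sdiff_sdiff
  rw [h1, h2, h3]
  have := add_self_eq_zero (bdry (O ∩ P))
  calc bdry (O \ P) + bdry (P \ O) = bdry (O \ P) + bdry (P \ O) + 0 := (add_zero _).symm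
    _ = _ := by rw [← this]; abel

/-- The sum over pairs `O ⊆ S ⊆ A` (the set of odd edges and the support of a current) of `f O S`
with weight `s` on odd edges and `q` on even edges of the support. -/
noncomputable def ex (s q : Sym2 V → ℝ≥0∞) (A : Finset (Sym2 V))
    (f : Finset (Sym2 V) → Finset (Sym2 V) → ℝ≥0∞) : ℝ≥0∞ :=
  ∑ S ∈ A.powerset, ∑ O ∈ S.powerset, (∏ e ∈ O, s e) * (∏ e ∈ S \ O, q e) * f O S

variable {s q : Sym2 V → ℝ≥0∞} {A : Finset (Sym2 V)}

theorem ex_mono {f g : Finset (Sym2 V) → Finset (Sym2 V) → ℝ≥0∞}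
    (h : ∀ S ⊆ A, ∀ O ⊆ S, f O S ≤ g O S) : ex s q A f ≤ ex s q A g := by
  refine Finset.sum_le_sum fun S hS => Finset.sum_le_sum fun O hO => ?_
  gcongr
  exact h S (Finset.mem_powerset.1 hS) O (Finset.mem_powerset.1 hO)

theorem ex_congr {f g : Finset (Sym2 V) → Finset (Sym2 V) → ℝ≥0∞}
    (h : ∀ S ⊆ A, ∀ O ⊆ S, f O S = g O S) : ex s q A f = ex s q A g :=
  le_antisymm (ex_mono fun S hS O hO => (h S hS O hO).le)
    (ex_mono fun S hS O hO => (h S hS O hO).ge)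

theorem ex_mul_left (a : ℝ≥0∞) (f : Finset (Sym2 V) → Finset (Sym2 V) → ℝ≥0∞) :
    ex s q A (fun O S => a * f O S) = a * ex s q A f := by
  simp only [ex, Finset.mul_sum]
  refine Finset.sum_congr rfl fun S _ => Finset.sum_congr rfl fun O _ => ?_
  ring

theorem ex_add (f g : Finset (Sym2 V) → Finset (Sym2 V) → ℝ≥0∞) :
    ex s q A (fun O S => f O S + g O S) = ex s q A f + ex s q A g := by
  simp only [ex, mul_add, Finset.sum_add_distrib]

theorem ex_sum {ι : Type*} (I : Finset ι) (f : ι → Finset (Sym2 V) → Finset (Sym2 V) → ℝ≥0∞) :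
    ex s q A (fun O S => ∑ i ∈ I, f i O S) = ∑ i ∈ I, ex s q A (f i) := by
  classical
  induction I using Finset.induction_on with
  | empty => simp [ex]
  | insert i I hi ih => simp only [Finset.sum_insert hi, ex_add, ih]

theorem ex_tsum {ι : Type*} (f : ι → Finset (Sym2 V) → Finset (Sym2 V) → ℝ≥0∞) :
    ex s q A (fun O S => ∑' i, f i O S) = ∑' i, ex s q A (f i) := by
  simp only [ex]
  rw [Summable.tsum_finsetSum fun _ _ => ENNReal.summable]
  refine Finset.sum_congr rfl fun S _ => ?_
  rw [Summable.tsum_finsetSum fun _ _ => ENNReal.summable]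
  refine Finset.sum_congr rfl fun O _ => ?_
  rw [ENNReal.tsum_mul_left]

theorem ex_empty (f : Finset (Sym2 V) → Finset (Sym2 V) → ℝ≥0∞) : ex s q ∅ f = f ∅ ∅ := by
  simp [ex]

theorem ex_insert {e : Sym2 V} (he : e ∉ A)
    (f : Finset (Sym2 V) → Finset (Sym2 V) → ℝ≥0∞) :
    ex s q (insert e A) f = ex s q A f + s e * ex s q A (fun O S => f (insert e O) (insert e S)) +
      q e * ex s q A (fun O S => f O (insert e S)) := by
  rw [ex, Finset.sum_powerset_insert he, add_assoc]
  congr 1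
  rw [ex, ex, Finset.mul_sum, Finset.mul_sum, ← Finset.sum_add_distrib]
  refine Finset.sum_congr rfl fun S hS => ?_
  have heS : e ∉ S := fun h => he (Finset.mem_powerset.1 hS h)
  rw [Finset.sum_powerset_insert heS, add_comm, Finset.mul_sum, Finset.mul_sum]
  congr 1
  · refine Finset.sum_congr rfl fun O hO => ?_
    have heO : e ∉ O := fun h => heS (Finset.mem_powerset.1 hO h)
    have : insert e S \ insert e O = S \ O := by
      ext a; simp only [Finset.mem_sdiff, Finset.mem_insert]
      constructor
      · rintro ⟨h1 | h1, h2⟩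
        · exact absurd (Or.inl h1) h2
        · exact ⟨h1, fun h => h2 (Or.inr h)⟩
      · rintro ⟨h1, h2⟩
        refine ⟨Or.inr h1, ?_⟩
        rintro (rfl | h)
        · exact heS h1
        · exact h2 h
    rw [this, Finset.prod_insert heO]; ring
  · refine Finset.sum_congr rfl fun O hO => ?_
    have heO : e ∉ O := fun h => heS (Finset.mem_powerset.1 hO h)
    rw [Finset.insert_sdiff_of_notMem _ heO, Finset.prod_insert (by simp [heS])]; ring

theorem ex_union {A' : Finset (Sym2 V)} (h : Disjoint A A')
    (f : Finset (Sym2 V) → Finset (Sym2 V) → ℝ≥0∞) :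
    ex s q (A ∪ A') f =
      ex s q A (fun O S => ex s q A' (fun O' S' => f (O ∪ O') (S ∪ S'))) := by
  induction A using Finset.induction_on generalizing f with
  | empty => simp [ex_empty]
  | insert e A he ih =>
    rw [Finset.disjoint_insert_left] at h
    have he' : e ∉ A ∪ A' := by simp [he, h.1]
    rw [Finset.insert_union, ex_insert he', ex_insert he, ih h.2, ih h.2, ih h.2]
    simp only [Finset.insert_union]

/-- The weighted sum over currents on `A` with sources `D` of a function of the support. -/
noncomputable def cur (s q : Sym2 V → ℝ≥0∞) (A : Finset (Sym2 V)) (D : V → ZMod 2)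
    (F : Finset (Sym2 V) → ℝ≥0∞) : ℝ≥0∞ :=
  open scoped Classical in ex s q A (fun O S => if bdry O = D then F S else 0)

variable {D : V → ZMod 2} {F F' : Finset (Sym2 V) → ℝ≥0∞}

theorem cur_mono (h : ∀ S ⊆ A, F S ≤ F' S) : cur s q A D F ≤ cur s q A D F' := by
  refine ex_mono fun S hS O _ => ?_
  split_ifs
  exacts [h S hS, le_rfl]

theorem cur_congr (h : ∀ S ⊆ A, F S = F' S) : cur s q A D F = cur s q A D F' :=
  le_antisymm (cur_mono fun S hS => (h S hS).le) (cur_mono fun S hS => (h S hS).ge)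

theorem cur_mul_left (a : ℝ≥0∞) : cur s q A D (fun S => a * F S) = a * cur s q A D F := by
  rw [cur, cur, ← ex_mul_left]
  simp only [mul_ite, mul_zero]

theorem cur_mul_right (a : ℝ≥0∞) : cur s q A D (fun S => F S * a) = cur s q A D F * a := by
  simp only [mul_comm _ a, cur_mul_left]

theorem cur_add : cur s q A D (fun S => F S + F' S) = cur s q A D F + cur s q A D F' := by
  rw [cur, cur, cur, ← ex_add]
  congr; funext O S; split_ifs <;> simp

theorem cur_tsum {ι : Type*} (F : ι → Finset (Sym2 V) → ℝ≥0∞) :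
    cur s q A D (fun S => ∑' i, F i S) = ∑' i, cur s q A D (F i) := by
  simp only [cur, ← ex_tsum]
  congr; funext O S; split_ifs <;> simp

theorem cur_empty (D : V → ZMod 2) [Decidable (D = 0)] :
    cur s q ∅ D F = if D = 0 then F ∅ else 0 := by
  rw [cur, ex_empty, bdry_empty]
  simp only [eq_comm]

theorem cur_insert {e : Sym2 V} (he : e ∉ A) (D : V → ZMod 2) (F : Finset (Sym2 V) → ℝ≥0∞) :
    cur s q (insert e A) D F = cur s q A D F +
      s e * cur s q A (D + bd e) (fun S => F (insert e S)) +
      q e * cur s q A D (fun S => F (insert e S)) := by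
  rw [cur, ex_insert he]
  congr 3
  refine ex_congr fun S hS O hO => ?_
  rw [bdry_insert fun h => he (hS (hO h))]
  have : bd e + bdry O = D ↔ bdry O = D + bd e := by
    constructor
    · rintro rfl
      rw [add_comm, ← add_assoc, add_self_eq_zero, zero_add]
    · intro h
      rw [h, add_comm, add_assoc, add_self_eq_zero, add_zero]
  classical exact if_congr this rfl rfl

/-- The partition function with sources `D`. -/
noncomputable def part (s q : Sym2 V → ℝ≥0∞) (A : Finset (Sym2 V)) (D : V → ZMod 2) : ℝ≥0∞ :=
  cur s q A D (fun _ => 1)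

theorem part_insert {e : Sym2 V} (he : e ∉ A) (D : V → ZMod 2) :
    part s q (insert e A) D = (1 + q e) * part s q A D + s e * part s q A (D + bd e) := by
  rw [part, cur_insert he]; simp only [part]; ring

theorem cur_const (a : ℝ≥0∞) : cur s q A D (fun _ => a) = a * part s q A D := by
  rw [part, ← cur_mul_left, mul_one]

theorem part_ne_top (hs : ∀ e, s e ≠ ∞) (hq : ∀ e, q e ≠ ∞) : part s q A D ≠ ∞ := by
  induction A using Finset.induction_on generalizing D with
  | empty => classical rw [part, cur_empty]; split_ifs <;> simp
  | insert e A he ih =>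
    rw [part_insert he]
    refine ENNReal.add_ne_top.2 ⟨ENNReal.mul_ne_top ?_ ih, ENNReal.mul_ne_top (hs e) ih⟩
    simp [hq e]

theorem one_le_part : 1 ≤ part s q A 0 := by
  induction A using Finset.induction_on with
  | empty => classical rw [part, cur_empty]; simp
  | insert e A he ih =>
    rw [part_insert he, add_mul, one_mul]
    exact ih.trans (le_add_right (le_add_right le_rfl))

/-! ### Switching -/

/-- `u` and `v` are joined by a path in `S`. -/
def Linked (S : Finset (Sym2 V)) (u v : V) : Prop :=
  Relation.ReflTransGen (fun a b => s(a, b) ∈ S) u v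

theorem Linked.symm {S : Finset (Sym2 V)} {u v : V} (h : Linked S u v) : Linked S v u :=
  have : Std.Symm (fun a b => s(a, b) ∈ S) := ⟨fun a b hab => by rwa [Sym2.eq_swap]⟩
  Std.Symm.symm (r := Relation.ReflTransGen (fun a b => s(a, b) ∈ S)) _ _ h

theorem Linked.trans {S : Finset (Sym2 V)} {u v w : V} (h : Linked S u v) (h' : Linked S v w) :
    Linked S u w := Relation.ReflTransGen.trans h h'

theorem Linked.refl (S : Finset (Sym2 V)) (u : V) : Linked S u u := Relation.ReflTransGen.refl

theorem Linked.mono {S S' : Finset (Sym2 V)} (hS : S ⊆ S') {u v : V} (h : Linked S u v) :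
    Linked S' u v := Relation.ReflTransGen.mono (fun _ _ hab => hS hab) _ _ h

/-- The sources of a current from `u` to `v`. -/
def ends (u v : V) : V → ZMod 2 := Pi.single u 1 + Pi.single v 1

theorem ends_self (u : V) : ends u u = 0 := add_self_eq_zero _

theorem Linked.exists_bdry {S : Finset (Sym2 V)} {u v : V} (h : Linked S u v) :
    ∃ P ⊆ S, bdry P = ends u v := by
  induction h with
  | refl => exact ⟨∅, by simp, by rw [bdry_empty, ends_self]⟩
  | @tail b c _ hbc ih =>
    obtain ⟨P, hP, hb⟩ := ih
    refine ⟨symmDiff P {s(b, c)}, ?_, ?_⟩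
    · intro e he
      rcases Finset.mem_symmDiff.1 he with h | h
      · exact hP h.1
      · rw [Finset.mem_singleton.1 h.1]; exact hbc
    · rw [bdry_symmDiff, hb, bdry, Finset.sum_singleton, bd_mk, ends, ends]
      have := add_self_eq_zero (Pi.single b 1 : V → ZMod 2)
      calc Pi.single u 1 + Pi.single b 1 + (Pi.single b 1 + Pi.single c 1)
          = Pi.single u 1 + (Pi.single b 1 + Pi.single b 1) + Pi.single c 1 := by abel
        _ = _ := by rw [this, add_zero]

/-- The number of subsets of `S` with boundary `D`. -/
noncomputable def count (S : Finset (Sym2 V)) (D : V → ZMod 2) : ℝ≥0∞ :=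
  open scoped Classical in ∑ O ∈ S.powerset, if bdry O = D then 1 else 0

theorem count_insert {e : Sym2 V} {S : Finset (Sym2 V)} (he : e ∉ S) (D : V → ZMod 2) :
    count (insert e S) D = count S D + count S (D + bd e) := by
  rw [count, Finset.sum_powerset_insert he]
  congr 1
  refine Finset.sum_congr rfl fun O hO => ?_
  rw [bdry_insert fun h => he (Finset.mem_powerset.1 hO h)]
  have : bd e + bdry O = D ↔ bdry O = D + bd e := by
    constructor
    · rintro rfl
      rw [add_comm, ← add_assoc, add_self_eq_zero, zero_add]
    · intro h
      rw [h, add_comm, add_assoc, add_self_eq_zero, add_zero]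
  classical exact if_congr this rfl rfl

theorem count_eq {S P : Finset (Sym2 V)} (hP : P ⊆ S) : count S (bdry P) = count S 0 := by
  have hm : ∀ O ∈ S.powerset, symmDiff O P ∈ S.powerset := by
    intro O hO
    rw [Finset.mem_powerset] at hO ⊢
    intro e he
    rcases Finset.mem_symmDiff.1 he with h | h
    · exact hO h.1
    · exact hP h.1
  refine Finset.sum_bij' (fun O _ => symmDiff O P) (fun O _ => symmDiff O P) hm hm
    (fun O _ => symmDiff_symmDiff_cancel_right P O) (fun O _ => symmDiff_symmDiff_cancel_right P O)
    fun O _ => ?_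
  rw [bdry_symmDiff]
  have : bdry O = bdry P ↔ bdry O + bdry P = 0 := by
    constructor
    · intro h; rw [h, add_self_eq_zero]
    · intro h
      have := congrArg (· + bdry P) h
      simpa [add_assoc, add_self_eq_zero] using this
  classical exact if_congr this rfl rfl

theorem count_le (S : Finset (Sym2 V)) (D : V → ZMod 2) : count S D ≤ count S 0 := by
  by_cases h : ∃ P ⊆ S, bdry P = D
  · obtain ⟨P, hP, rfl⟩ := h
    exact (count_eq hP).le
  · push Not at h
    rw [count, Finset.sum_eq_zero]
    · exact zero_le
    · intro O hO
      rw [if_neg (h O (Finset.mem_powerset.1 hO))]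

/-- A pair of currents, expressed through the sum of the two. -/
theorem cur_cur (hsq : ∀ e, 2 * q e + q e ^ 2 = s e ^ 2) (D₁ D₂ : V → ZMod 2)
    (F : Finset (Sym2 V) → ℝ≥0∞) :
    cur s q A D₁ (fun S => cur s q A D₂ (fun S' => F (S ∪ S'))) =
      cur (fun e => s e * (1 + q e)) (fun e => s e ^ 2) A (D₁ + D₂)
        (fun S => count S D₁ * F S) := by
  induction A using Finset.induction_on generalizing D₁ D₂ F with
  | empty =>
    classical
    simp only [cur_empty]
    by_cases h1 : D₁ = 0
    · subst h1
      simp [count, Finset.filter_singleton]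
    · rw [if_neg h1, eq_comm]
      simp [count, Ne.symm h1]
  | insert e A he ih =>
    rw [cur_insert he, cur_insert he]
    have hc : ∀ (D : V → ZMod 2) S, S ⊆ A → (count (insert e S) D₁ * F (insert e S)) =
        count S D₁ * F (insert e S) + count S (D₁ + bd e) * F (insert e S) := by
      intro D S hS
      rw [count_insert (fun h => he (hS h)), add_mul]
    rw [cur_congr (hc (D₁ + D₂ + bd e)), cur_congr (hc (D₁ + D₂)), cur_add, cur_add]
    simp only [cur_insert he, cur_add, cur_mul_left, Finset.insert_union, Finset.union_insert,
      Finset.insert_idem]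
    simp only [ih, ih _ _ (fun S => F (insert e S))]
    have e1 : D₁ + (D₂ + bd e) = D₁ + D₂ + bd e := by abel
    have e2 : D₁ + bd e + D₂ = D₁ + D₂ + bd e := by abel
    have e3 : D₁ + bd e + (D₂ + bd e) = D₁ + D₂ := by
      calc D₁ + bd e + (D₂ + bd e) = D₁ + D₂ + (bd e + bd e) := by abel
        _ = _ := by rw [add_self_eq_zero, add_zero]
    simp only [e1, e2, e3]
    have hY : s e ^ 2 * cur (fun e => s e * (1 + q e)) (fun e => s e ^ 2) A (D₁ + D₂)
        (fun S => count S D₁ * F (insert e S)) = (2 * q e + q e ^ 2) *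
          cur (fun e => s e * (1 + q e)) (fun e => s e ^ 2) A (D₁ + D₂)
            (fun S => count S D₁ * F (insert e S)) := by rw [hsq]
    rw [mul_add (s e ^ 2), hY]
    ring

/-- The second Griffiths inequality. -/
theorem part_mul_part_le (hsq : ∀ e, 2 * q e + q e ^ 2 = s e ^ 2) (D₁ D₂ : V → ZMod 2) :
    part s q A D₁ * part s q A D₂ ≤ part s q A 0 * part s q A (D₁ + D₂) := by
  have h : ∀ D D', part s q A D * part s q A D' =
      cur s q A D (fun S => cur s q A D' (fun S' => (fun _ => 1) (S ∪ S'))) := by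
    intro D D'
    rw [mul_comm, ← cur_const]; rfl
  rw [h, h]
  refine (cur_cur hsq D₁ D₂ fun _ => 1).trans_le
    (le_trans ?_ (cur_cur hsq 0 (D₁ + D₂) fun _ => 1).ge)
  rw [zero_add]
  refine cur_mono fun S _ => ?_
  gcongr
  exact count_le S D₁

theorem part_mono_ratio (hsq : ∀ e, 2 * q e + q e ^ 2 = s e ^ 2) (hs : ∀ e, s e ≠ ∞)
    (hq : ∀ e, q e ≠ ∞) {B : Finset (Sym2 V)} (h : A ⊆ B) (D : V → ZMod 2) :
    part s q A D * part s q B 0 ≤ part s q B D * part s q A 0 := by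
  suffices H : ∀ C : Finset (Sym2 V), part s q A D * part s q (A ∪ C) 0 ≤
      part s q (A ∪ C) D * part s q A 0 by
    simpa [Finset.union_eq_right.2 h] using H B
  intro C
  induction C using Finset.induction_on with
  | empty => simp
  | insert e C _ ih =>
    rw [Finset.union_insert]
    by_cases he : e ∈ A ∪ C
    · rwa [Finset.insert_eq_of_mem he]
    have h0 : part s q (A ∪ C) 0 ≠ 0 := (zero_lt_one.trans_le one_le_part).ne'
    have hstep : part s q (A ∪ C) D * part s q (insert e (A ∪ C)) 0 ≤
        part s q (insert e (A ∪ C)) D * part s q (A ∪ C) 0 := by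
      rw [part_insert he, part_insert he, zero_add]
      calc _ = (1 + q e) * (part s q (A ∪ C) D * part s q (A ∪ C) 0) +
            s e * (part s q (A ∪ C) D * part s q (A ∪ C) (bd e)) := by ring
        _ ≤ (1 + q e) * (part s q (A ∪ C) D * part s q (A ∪ C) 0) +
            s e * (part s q (A ∪ C) 0 * part s q (A ∪ C) (D + bd e)) := by
          gcongr _ + _ * ?_
          exact part_mul_part_le hsq _ _
        _ = _ := by ring
    rw [← ENNReal.mul_le_mul_iff_left h0 (part_ne_top hs hq)]
    calc _ = part s q A D * part s q (A ∪ C) 0 * part s q (insert e (A ∪ C)) 0 := by ring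
      _ ≤ part s q (A ∪ C) D * part s q A 0 * part s q (insert e (A ∪ C)) 0 := by gcongr
      _ = part s q (A ∪ C) D * part s q (insert e (A ∪ C)) 0 * part s q A 0 := by ring
      _ ≤ part s q (insert e (A ∪ C)) D * part s q (A ∪ C) 0 * part s q A 0 := by gcongr
      _ = _ := by ring

open scoped Classical in
/-- Switching: a single sourceless current connects two points with probability at most the square
of the two-point function. -/
theorem cur_linked_mul_part_le (hsq : ∀ e, 2 * q e + q e ^ 2 = s e ^ 2) (a b : V) :
    cur s q A 0 (fun S => if Linked S a b then 1 else 0) * part s q A 0 ≤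
      part s q A (ends a b) ^ 2 := by
  have h1 : cur s q A 0 (fun S => if Linked S a b then 1 else 0) * part s q A 0 ≤
      cur s q A 0 (fun S => cur s q A 0
        (fun S' => (fun S => if Linked S a b then 1 else 0) (S ∪ S'))) := by
    rw [← cur_mul_right]
    refine cur_mono fun S _ => ?_
    rw [← cur_const]
    refine cur_mono fun S' _ => ?_
    by_cases h : Linked S a b
    · simp only [h, h.mono (Finset.subset_union_left (s₂ := S'))]; simp
    · simp [h]
  have h2 : part s q A (ends a b) ^ 2 = cur s q A (ends a b) (fun S => cur s q A (ends a b)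
        (fun S' => (fun _ => 1) (S ∪ S'))) := by
    rw [sq, ← cur_const]; rfl
  refine h1.trans ?_
  rw [h2]
  refine (cur_cur hsq 0 0 fun S => if Linked S a b then 1 else 0).trans_le
    (le_trans ?_ (cur_cur hsq (ends a b) (ends a b) fun _ => 1).ge)
  rw [add_self_eq_zero (ends a b), add_zero]
  refine cur_mono fun S _ => ?_
  by_cases h : Linked S a b
  · obtain ⟨P, hP, hb⟩ := h.exists_bdry
    rw [← hb, count_eq hP]
    simp [h]
  · simp [h]

end RandomCurrent

namespace RandomCurrent

variable {V : Type*} [DecidableEq V] {s q : Sym2 V → ℝ≥0∞}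

theorem bd_apply_of_notMem {e : Sym2 V} {v : V} (h : v ∉ e) : bd e v = 0 := by
  induction e using Sym2.ind with
  | _ x y =>
    rw [Sym2.mem_iff, not_or] at h
    rw [bd_mk, Pi.add_apply, Pi.single_eq_of_ne h.1, Pi.single_eq_of_ne h.2, add_zero]

theorem bdry_apply_of_notMem {O : Finset (Sym2 V)} {v : V} (h : ∀ e ∈ O, v ∉ e) :
    bdry O v = 0 := by
  rw [bdry, Finset.sum_apply]
  exact Finset.sum_eq_zero fun e he => bd_apply_of_notMem (h e he)

open scoped Classical in
/-- The edges of `A` that touch the cluster of `a` in `S`. -/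
noncomputable def touching (A : Finset (Sym2 V)) (a : V) (S : Finset (Sym2 V)) :
    Finset (Sym2 V) :=
  A.filter fun e => ∃ v ∈ e, Linked S a v

theorem mem_touching {A S : Finset (Sym2 V)} {a : V} {e : Sym2 V} :
    e ∈ touching A a S ↔ e ∈ A ∧ ∃ v ∈ e, Linked S a v := by
  classical exact Finset.mem_filter

theorem ex_eq_zero {A : Finset (Sym2 V)} {f : Finset (Sym2 V) → Finset (Sym2 V) → ℝ≥0∞}
    (h : ∀ S ⊆ A, ∀ O ⊆ S, f O S = 0) : ex s q A f = 0 := by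
  rw [ex_congr h]
  simp [ex]

theorem linked_union_iff {S₁ S₂ : Finset (Sym2 V)} {a : V}
    (h : ∀ e ∈ S₂, ∀ v ∈ e, ¬ Linked S₁ a v) (v : V) :
    Linked (S₁ ∪ S₂) a v ↔ Linked S₁ a v := by
  refine ⟨fun hv => ?_, fun hv => hv.mono Finset.subset_union_left⟩
  induction hv with
  | refl => exact Linked.refl _ _
  | @tail b c _ hbc ih =>
    rcases Finset.mem_union.1 hbc with hbc | hbc
    · exact Relation.ReflTransGen.tail ih hbc
    · exact absurd ih (h _ hbc b (Sym2.mem_mk_left b c))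

theorem touching_union_iff {A M S₁ S₂ : Finset (Sym2 V)} (a : V) (h2 : S₂ ⊆ A \ M) :
    touching A a (S₁ ∪ S₂) = M ↔ touching A a S₁ = M := by
  have key : touching A a S₁ = M → ∀ e ∈ S₂, ∀ v ∈ e, ¬ Linked S₁ a v := by
    intro hM e he v hv hl
    have := Finset.mem_sdiff.1 (h2 he)
    rw [← hM] at this
    exact this.2 (mem_touching.2 ⟨this.1, v, hv, hl⟩)
  have key' : touching A a (S₁ ∪ S₂) = M → ∀ e ∈ S₂, ∀ v ∈ e, ¬ Linked S₁ a v := by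
    intro hM e he v hv hl
    have := Finset.mem_sdiff.1 (h2 he)
    rw [← hM] at this
    exact this.2 (mem_touching.2 ⟨this.1, v, hv, hl.mono Finset.subset_union_left⟩)
  constructor
  · intro h
    rw [← h]
    ext e
    simp only [mem_touching, linked_union_iff (key' h)]
  · intro h
    rw [← h]
    ext e
    simp only [mem_touching, linked_union_iff (key h)]

open scoped Classical in
theorem ex_eq_sum_touching (A : Finset (Sym2 V)) (a : V)
    (f : Finset (Sym2 V) → Finset (Sym2 V) → ℝ≥0∞) :
    ex s q A f = ∑ M ∈ A.powerset, ex s q M (fun O₁ S₁ => ex s q (A \ M) (fun O₂ S₂ =>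
      if touching A a (S₁ ∪ S₂) = M then f (O₁ ∪ O₂) (S₁ ∪ S₂) else 0)) := by
  have h1 : ex s q A f =
      ex s q A (fun O S => ∑ M ∈ A.powerset, if touching A a S = M then f O S else 0) := by
    refine ex_congr fun S _ O _ => ?_
    rw [Finset.sum_ite_eq, if_pos]
    exact Finset.mem_powerset.2 (Finset.filter_subset _ _)
  rw [h1, ex_sum]
  refine Finset.sum_congr rfl fun M hM => ?_
  conv_lhs => rw [← Finset.union_sdiff_of_subset (Finset.mem_powerset.1 hM)]
  rw [ex_union Finset.disjoint_sdiff]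
  simp only [Finset.union_sdiff_of_subset (Finset.mem_powerset.1 hM)]

theorem bdry_union_eq_zero_iff {A M S₁ S₂ O₁ O₂ : Finset (Sym2 V)} {a : V}
    (hM : touching A a S₁ = M) (h1 : S₁ ⊆ M) (h2 : S₂ ⊆ A \ M) (hO₁ : O₁ ⊆ S₁) (hO₂ : O₂ ⊆ S₂) :
    bdry (O₁ ∪ O₂) = 0 ↔ bdry O₁ = 0 ∧ bdry O₂ = 0 := by
  have hd : Disjoint O₁ O₂ := by
    refine Finset.disjoint_left.2 fun e he he' => ?_
    exact (Finset.mem_sdiff.1 (h2 (hO₂ he'))).2 (h1 (hO₁ he))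
  rw [bdry_union hd]
  refine ⟨fun h => ?_, fun h => by rw [h.1, h.2, add_zero]⟩
  have hv : ∀ v, bdry O₁ v = 0 ∧ bdry O₂ v = 0 := by
    intro v
    have hsum : bdry O₁ v + bdry O₂ v = 0 := congrFun h v
    by_cases hl : Linked S₁ a v
    · have : bdry O₂ v = 0 := by
        refine bdry_apply_of_notMem fun e he hve => ?_
        have := Finset.mem_sdiff.1 (h2 (hO₂ he))
        rw [← hM] at this
        exact this.2 (mem_touching.2 ⟨this.1, v, hve, hl⟩)
      rw [this, add_zero] at hsum
      exact ⟨hsum, this⟩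
    · have : bdry O₁ v = 0 := by
        refine bdry_apply_of_notMem fun e he hve => ?_
        have heM := h1 (hO₁ he)
        rw [← hM] at heM
        obtain ⟨u, hu, hlu⟩ := (mem_touching.1 heM).2
        rcases eq_or_ne u v with rfl | huv
        · exact hl hlu
        · have : e = s(u, v) := (Sym2.mem_and_mem_iff huv).1 ⟨hu, hve⟩
          subst this
          exact hl (Relation.ReflTransGen.tail hlu (hO₁ he))
      rw [this, zero_add] at hsum
      exact ⟨this, hsum⟩
  exact ⟨funext fun v => (hv v).1, funext fun v => (hv v).2⟩

/-- Each pair in `l` is linked in `S`, and distinct pairs lie in distinct clusters. -/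
def Separate (S : Finset (Sym2 V)) (l : List (V × V)) : Prop :=
  (∀ p ∈ l, Linked S p.1 p.2) ∧ l.Pairwise fun p p' => ¬ Linked S p.1 p'.1

theorem Separate.of_cons_union {A M S₁ S₂ : Finset (Sym2 V)} {p : V × V} {l : List (V × V)}
    (hM : touching A p.1 S₁ = M) (h1 : S₁ ⊆ M) (h2 : S₂ ⊆ A \ M)
    (h : Separate (S₁ ∪ S₂) (p :: l)) : Linked S₁ p.1 p.2 ∧ Separate S₂ l := by
  have key : ∀ e ∈ S₂, ∀ v ∈ e, ¬ Linked S₁ p.1 v := by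
    intro e he v hv hl
    have := Finset.mem_sdiff.1 (h2 he)
    rw [← hM] at this
    exact this.2 (mem_touching.2 ⟨this.1, v, hv, hl⟩)
  obtain ⟨hl, hp⟩ := h
  rw [List.pairwise_cons] at hp
  refine ⟨(linked_union_iff key _).1 (hl p List.mem_cons_self), ?_, ?_⟩
  · intro p' hp'
    have hnot := hp.1 p' hp'
    have hlink := hl p' (List.mem_cons_of_mem _ hp')
    rw [linked_union_iff key] at hnot
    have : ∀ v, Linked (S₁ ∪ S₂) p'.1 v → Linked S₂ p'.1 v ∧ ¬ Linked S₁ p.1 v := by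
      intro v hv
      induction hv with
      | refl => exact ⟨Linked.refl _ _, hnot⟩
      | @tail b c _ hbc ih =>
        rcases Finset.mem_union.1 hbc with hbc | hbc
        · exfalso
          have heM := h1 hbc
          rw [← hM] at heM
          obtain ⟨u, hu, hlu⟩ := (mem_touching.1 heM).2
          rcases Sym2.mem_iff.1 hu with rfl | rfl
          · exact ih.2 hlu
          · exact ih.2 (Relation.ReflTransGen.tail hlu (by rwa [Sym2.eq_swap]))
        · exact ⟨Relation.ReflTransGen.tail ih.1 hbc, key _ hbc c (Sym2.mem_mk_right b c)⟩
    exact (this _ hlink).1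
  · exact hp.2.imp fun h hl => h (hl.mono Finset.subset_union_right)

open scoped Classical in
/-- Connections within distinct clusters of a sourceless current are bounded by a product of
squared two-point functions. -/
theorem cur_separate_le (hsq : ∀ e, 2 * q e + q e ^ 2 = s e ^ 2) (hs : ∀ e, s e ≠ ∞)
    (hq : ∀ e, q e ≠ ∞) {g : V → V → ℝ≥0∞}
    (hg : ∀ A x y, part s q A (ends x y) ≤ g x y * part s q A 0) (l : List (V × V))
    (A : Finset (Sym2 V)) :
    cur s q A 0 (fun S => if Separate S l then 1 else 0) ≤
      (l.map fun p => g p.1 p.2 ^ 2).prod * part s q A 0 := by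
  induction l generalizing A with
  | nil =>
    simp only [List.map_nil, List.prod_nil, one_mul]
    exact cur_mono fun S _ => by split_ifs <;> simp
  | cons p l ih =>
    have hlink : cur s q A 0 (fun S => if Linked S p.1 p.2 then 1 else 0) ≤
        g p.1 p.2 ^ 2 * part s q A 0 := by
      rw [← ENNReal.mul_le_mul_iff_left (zero_lt_one.trans_le (one_le_part (A := A))).ne'
        (part_ne_top hs hq)]
      refine (cur_linked_mul_part_le hsq p.1 p.2).trans ?_
      calc _ ≤ (g p.1 p.2 * part s q A 0) ^ 2 := by gcongr; exact hg A p.1 p.2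
        _ = _ := by ring
    rw [List.map_cons, List.prod_cons]
    set K := (l.map fun p => g p.1 p.2 ^ 2).prod
    refine le_trans ?_ (le_of_le_of_eq (mul_le_mul_right hlink K) (by ring))
    rw [cur, cur, ex_eq_sum_touching A p.1, ex_eq_sum_touching A p.1, Finset.mul_sum]
    refine Finset.sum_le_sum fun M _ => ?_
    rw [← ex_mul_left]
    refine ex_mono fun S₁ h1 O₁ hO₁ => ?_
    by_cases hM : touching A p.1 S₁ = M
    swap
    · refine le_trans (le_of_eq ?_) zero_le
      refine ex_eq_zero fun S₂ h2 O₂ _ => ?_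
      rw [if_neg (by rwa [touching_union_iff _ h2])]
    by_cases hc : bdry O₁ = 0 ∧ Linked S₁ p.1 p.2
    · calc _ ≤ cur s q (A \ M) 0 (fun S => if Separate S l then 1 else 0) := by
            rw [cur]
            refine ex_mono fun S₂ h2 O₂ hO₂ => ?_
            split_ifs with h3 h4 h5 h6 h7 <;> first | exact zero_le | exact le_rfl | skip
            · exact absurd (h5.of_cons_union hM h1 h2).2 h7
            · exact absurd ((bdry_union_eq_zero_iff hM h1 h2 hO₁ hO₂).1 h4).2 h6
        _ ≤ K * part s q (A \ M) 0 := ih _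
        _ ≤ _ := by
            gcongr
            rw [part, cur]
            refine ex_mono fun S₂ h2 O₂ hO₂ => ?_
            rw [if_pos ((touching_union_iff _ h2).2 hM)]
            simp only [bdry_union_eq_zero_iff hM h1 h2 hO₁ hO₂, hc.1, true_and]
            rw [if_pos (hc.2.mono Finset.subset_union_left)]
    · refine le_trans (le_of_eq ?_) zero_le
      refine ex_eq_zero fun S₂ h2 O₂ hO₂ => ?_
      split_ifs with h3 h4 h5 <;> try rfl
      exact absurd ⟨((bdry_union_eq_zero_iff hM h1 h2 hO₁ hO₂).1 h4).1,
        (h5.of_cons_union hM h1 h2).1⟩ hc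

end RandomCurrent

namespace RandomCurrent

variable {V : Type*} [DecidableEq V]

/-- The outcome of exploring the backbone of a current: the vertices visited, the explored odd and
even edges, and the unexplored edges. -/
structure Run (V : Type*) where
  path : List V
  odd : Finset (Sym2 V)
  even : Finset (Sym2 V)
  rest : Finset (Sym2 V)

open scoped Classical in
/-- All possible explorations of `A` from `y` until `x` is reached, with at most `n` steps. -/
noncomputable def runs (x : V) : ℕ → Finset (Sym2 V) → V → List (Run V)
  | 0, A, y => if y = x then [⟨[x], ∅, ∅, A⟩] else []
  | n + 1, A, y =>
    if y = x then [⟨[x], ∅, ∅, A⟩] else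
    if h : ∃ y', s(y, y') ∈ A then
      (runs x n (A.erase s(y, h.choose)) y).map
          (fun r => ⟨r.path, r.odd, insert s(y, h.choose) r.even, r.rest⟩) ++
        (runs x n (A.erase s(y, h.choose)) h.choose).map
          (fun r => ⟨y :: r.path, insert s(y, h.choose) r.odd, r.even, r.rest⟩)
    else []

variable {x y : V} {n : ℕ} {A : Finset (Sym2 V)}

theorem runs_self (x : V) (n : ℕ) (A : Finset (Sym2 V)) :
    runs x n A x = [⟨[x], ∅, ∅, A⟩] := by
  cases n <;> simp [runs]

theorem runs_eq_nil (hyx : y ≠ x) (h : ∀ y', s(y, y') ∉ A) : runs x n A y = [] := by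
  cases n <;> simp [runs, hyx, h]

theorem runs_succ (hyx : y ≠ x) (h : ∃ y', s(y, y') ∈ A) :
    ∃ y', s(y, y') ∈ A ∧ runs x (n + 1) A y =
      (runs x n (A.erase s(y, y')) y).map
          (fun r => ⟨r.path, r.odd, insert s(y, y') r.even, r.rest⟩) ++
        (runs x n (A.erase s(y, y')) y').map
          (fun r => ⟨y :: r.path, insert s(y, y') r.odd, r.even, r.rest⟩) := by
  refine ⟨h.choose, h.choose_spec, ?_⟩
  rw [runs, if_neg hyx, dif_pos h]

/-- Induction along the exploration of the backbone. -/
theorem runs_induction (x : V) {motive : ∀ (n : ℕ) (A : Finset (Sym2 V)), A.card ≤ n → V → Prop}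
    (self : ∀ n A hA, runs x n A x = [⟨[x], ∅, ∅, A⟩] → motive n A hA x)
    (stuck : ∀ n A hA y, y ≠ x → (∀ y', s(y, y') ∉ A) → runs x n A y = [] → motive n A hA y)
    (step : ∀ n A (hA : A.card ≤ n) y y' hA', y ≠ x → s(y, y') ∉ A →
      runs x (n + 1) (insert s(y, y') A) y =
      (runs x n A y).map (fun r => ⟨r.path, r.odd, insert s(y, y') r.even, r.rest⟩) ++
        (runs x n A y').map
          (fun r => ⟨y :: r.path, insert s(y, y') r.odd, r.even, r.rest⟩) →
      motive n A hA y → motive n A hA y' → motive (n + 1) (insert s(y, y') A) hA' y)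
    (n : ℕ) (A : Finset (Sym2 V)) (hA : A.card ≤ n) (y : V) : motive n A hA y := by
  induction n generalizing A y with
  | zero =>
    have hA0 := hA
    rw [Nat.le_zero, Finset.card_eq_zero] at hA0
    subst hA0
    by_cases hyx : y = x
    · subst hyx; exact self _ _ _ (runs_self _ _ _)
    · exact stuck _ _ _ _ hyx (by simp) (runs_eq_nil hyx (by simp))
  | succ n ih =>
    by_cases hyx : y = x
    · subst hyx; exact self _ _ _ (runs_self _ _ _)
    by_cases h : ∃ y', s(y, y') ∈ A
    · obtain ⟨y', hy', hr⟩ := runs_succ (n := n) hyx h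
      have hc : (A.erase s(y, y')).card ≤ n := by
        rw [Finset.card_erase_of_mem hy']; omega
      have := step n (A.erase s(y, y')) hc y y' (by rwa [Finset.insert_erase hy']) hyx
        (Finset.notMem_erase _ _) (by rw [Finset.insert_erase hy', hr]) (ih _ hc _) (ih _ hc _)
      simpa only [Finset.insert_erase hy'] using this
    · push Not at h
      exact stuck _ _ _ _ hyx h (runs_eq_nil hyx h)

theorem runs_subset (hA : A.card ≤ n) : ∀ r ∈ runs x n A y, r.odd ⊆ A ∧ r.even ⊆ A := by
  induction n, A, hA, y using runs_induction x with
  | self n A hA h => rw [h]; simp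
  | stuck n A hA y _ _ h => rw [h]; simp
  | step n A hA y y' _ _ _ h ih1 ih2 =>
    rw [h]
    intro r hr
    rw [List.mem_append, List.mem_map, List.mem_map] at hr
    rcases hr with ⟨r, hr, rfl⟩ | ⟨r, hr, rfl⟩
    · have := ih1 r hr
      exact ⟨this.1.trans (Finset.subset_insert _ _), Finset.insert_subset_insert _ this.2⟩
    · have := ih2 r hr
      exact ⟨Finset.insert_subset_insert _ this.1, this.2.trans (Finset.subset_insert _ _)⟩

theorem exists_path_of_mem_runs (hA : A.card ≤ n) : ∀ r ∈ runs x n A y, ∃ (T : ℕ) (ω : ℕ → V),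
    r.path = (List.range (T + 1)).map ω ∧ ω 0 = y ∧ ω T = x ∧ (∀ m < T, ω m ≠ x) ∧
    (∀ e ∈ r.odd, ∃ m < T, e = s(ω m, ω (m + 1))) ∧ ∀ e ∈ r.even, ∃ m < T, ω m ∈ e := by
  induction n, A, hA, y using runs_induction x with
  | self n A hA h => rw [h]; simpa using ⟨0, fun _ => x, by simp⟩
  | stuck n A hA y _ _ h => rw [h]; simp
  | step n A hA y y' _ hyx _ h ih1 ih2 =>
    rw [h]
    intro r hr
    rw [List.mem_append, List.mem_map, List.mem_map] at hr
    rcases hr with ⟨r, hr, rfl⟩ | ⟨r, hr, rfl⟩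
    · obtain ⟨T, ω, h1, h2, h3, h4, h5, h6⟩ := ih1 r hr
      refine ⟨T, ω, h1, h2, h3, h4, h5, ?_⟩
      intro e he
      rcases Finset.mem_insert.1 he with rfl | he
      · refine ⟨0, ?_, by rw [h2]; exact Sym2.mem_mk_left _ _⟩
        rcases Nat.eq_zero_or_pos T with rfl | hT
        · exact absurd (h2.symm.trans h3) hyx
        · exact hT
      · exact h6 e he
    · obtain ⟨T, ω, h1, h2, h3, h4, h5, h6⟩ := ih2 r hr
      refine ⟨T + 1, fun m => Nat.casesOn m y ω, ?_, rfl, h3, ?_, ?_, ?_⟩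
      · rw [List.range_succ_eq_map, List.map_cons, List.map_map, h1]
        rfl
      · rintro (_ | m) hm
        · exact hyx
        · exact h4 m (by omega)
      · intro e he
        rcases Finset.mem_insert.1 he with rfl | he
        · exact ⟨0, by omega, by simp [h2]⟩
        · obtain ⟨m, hm, rfl⟩ := h5 e he
          exact ⟨m + 1, by omega, rfl⟩
      · intro e he
        obtain ⟨m, hm, hme⟩ := h6 e he
        exact ⟨m + 1, by omega, hme⟩

variable {s q : Sym2 V → ℝ≥0∞}

theorem ends_add_bd (y y' x : V) : ends y x + bd s(y, y') = ends y' x := by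
  have := add_self_eq_zero (Pi.single y 1 : V → ZMod 2)
  rw [ends, ends, bd_mk]
  calc _ = Pi.single y 1 + Pi.single y 1 + (Pi.single y' 1 + Pi.single x 1) := by abel
    _ = _ := by rw [this, zero_add]

/-- The decomposition of a current with sources `y`, `x` according to its backbone. -/
theorem cur_ends_eq_sum_runs (hA : A.card ≤ n) (F : Finset (Sym2 V) → ℝ≥0∞) :
    cur s q A (ends y x) F = ((runs x n A y).map fun r => (∏ e ∈ r.odd, s e) *
      ∑ R ∈ r.even.powerset, (∏ e ∈ R, q e) *
        cur s q r.rest 0 (fun S => F (r.odd ∪ R ∪ S))).sum := by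
  induction n, A, hA, y using runs_induction x generalizing F with
  | self n A hA h => rw [h, ends_self]; simp
  | stuck n A hA y hyx hn h =>
    rw [h, List.map_nil, List.sum_nil, cur]
    refine ex_eq_zero fun S hS O hO => ?_
    rw [if_neg]
    intro hb
    have h0 : bdry O y = 0 := by
      refine bdry_apply_of_notMem fun e he hy => ?_
      obtain ⟨y', rfl⟩ := Sym2.mem_iff_exists.1 hy
      exact hn y' (hS (hO he))
    rw [hb, ends, Pi.add_apply, Pi.single_eq_same, Pi.single_eq_of_ne hyx] at h0
    simp at h0
  | step n A hA y y' _ hyx he h ih1 ih2 =>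
    rw [h, cur_insert he, ends_add_bd, ih1, ih1, ih2, List.map_append, List.sum_append,
      List.map_map, List.map_map]
    set e := s(y, y')
    rw [← List.sum_map_mul_left, ← List.sum_map_mul_left, add_right_comm, ← List.sum_map_add]
    congr 2
    · refine List.map_congr_left fun r hr => ?_
      have her : e ∉ r.even := fun h => he ((runs_subset hA r hr).2 h)
      simp only [Function.comp]
      rw [Finset.sum_powerset_insert her, mul_add, mul_left_comm, Finset.mul_sum (a := q e)]
      congr 2
      refine Finset.sum_congr rfl fun R hR => ?_
      rw [Finset.prod_insert fun h => her (Finset.mem_powerset.1 hR h), mul_assoc]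
      simp only [Finset.insert_union, Finset.union_insert]
    · refine List.map_congr_left fun r hr => ?_
      have her : e ∉ r.odd := fun h => he ((runs_subset hA r hr).1 h)
      simp only [Function.comp]
      rw [Finset.prod_insert her, mul_assoc]
      simp only [Finset.insert_union]

/-! ### Hitting estimates for the backbone -/

open scoped Classical in
/-- The total weight of the backbones from `y` to `x` with a given property, the explored even
edges and the unexplored part of the current being unconstrained. -/
noncomputable def backboneSum (s q : Sym2 V → ℝ≥0∞) (x : V) (n : ℕ) (A : Finset (Sym2 V)) (y : V)
    (Φ : List V → Prop) : ℝ≥0∞ :=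
  ((runs x n A y).map fun r => (∏ e ∈ r.odd, s e) * (∏ e ∈ r.even, (1 + q e)) *
    part s q r.rest 0 * if Φ r.path then 1 else 0).sum

theorem backboneSum_mono {Φ Ψ : List V → Prop}
    (h : ∀ r ∈ runs x n A y, Φ r.path → Ψ r.path) :
    backboneSum s q x n A y Φ ≤ backboneSum s q x n A y Ψ := by
  refine List.sum_le_sum fun r hr => ?_
  gcongr
  by_cases hΦ : Φ r.path
  · rw [if_pos hΦ, if_pos (h r hr hΦ)]
  · rw [if_neg hΦ]; exact zero_le

theorem backboneSum_eq_zero {Φ : List V → Prop}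
    (h : ∀ r ∈ runs x n A y, ¬ Φ r.path) : backboneSum s q x n A y Φ = 0 := by
  refine List.sum_eq_zero fun a ha => ?_
  obtain ⟨r, hr, rfl⟩ := List.mem_map.1 ha
  rw [if_neg (h r hr), mul_zero]

theorem backboneSum_step {y' : V} (he : s(y, y') ∉ A) (hA : A.card ≤ n)
    (h : runs x (n + 1) (insert s(y, y') A) y =
      (runs x n A y).map (fun r => ⟨r.path, r.odd, insert s(y, y') r.even, r.rest⟩) ++
        (runs x n A y').map
          (fun r => ⟨y :: r.path, insert s(y, y') r.odd, r.even, r.rest⟩)) (Φ : List V → Prop) :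
    backboneSum s q x (n + 1) (insert s(y, y') A) y Φ =
      (1 + q s(y, y')) * backboneSum s q x n A y Φ +
        s s(y, y') * backboneSum s q x n A y' (fun ω => Φ (y :: ω)) := by
  rw [backboneSum, h, List.map_append, List.sum_append, List.map_map, List.map_map, backboneSum,
    backboneSum, ← List.sum_map_mul_left, ← List.sum_map_mul_left]
  congr 2
  · refine List.map_congr_left fun r hr => ?_
    simp only [Function.comp]
    rw [Finset.prod_insert fun h => he ((runs_subset hA r hr).2 h)]
    ring
  · refine List.map_congr_left fun r hr => ?_
    simp only [Function.comp]
    rw [Finset.prod_insert fun h => he ((runs_subset hA r hr).1 h)]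
    ring

/-- Some suffix of the list `ω` starts at `v` and satisfies `Φ`. -/
def Hits (v : V) (Φ : List V → Prop) (ω : List V) : Prop := ∃ ω₁, (v :: ω₁) <:+ ω ∧ Φ (v :: ω₁)

theorem path_eq_cons (hA : A.card ≤ n) {r : Run V} (hr : r ∈ runs x n A y) :
    ∃ ω, r.path = y :: ω := by
  obtain ⟨T, ω, h1, h2, -⟩ := exists_path_of_mem_runs hA r hr
  rw [List.range_succ_eq_map, List.map_cons, h2] at h1
  exact ⟨_, h1⟩

/-- If passing through `v` at some time, the backbone splits at its first visit to `v`. -/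
theorem backboneSum_hits_le {v : V} {Φ : List V → Prop} {κ : ℝ≥0∞}
    (hκ : ∀ n A, A.card ≤ n → backboneSum s q x n A v Φ ≤ κ * part s q A 0)
    (hΦ : ∀ ω₁ ω₂, (v :: ω₁) <:+ (v :: ω₂) → Φ (v :: ω₁) → Φ (v :: ω₂)) (hA : A.card ≤ n) :
    backboneSum s q x n A y (Hits v Φ) ≤ κ * part s q A (ends y v) := by
  have hv : ∀ n A, A.card ≤ n →
      backboneSum s q x n A v (Hits v Φ) ≤ κ * part s q A (ends v v) := by
    intro n A hA
    rw [ends_self]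
    refine (backboneSum_mono fun r hr hh => ?_).trans (hκ n A hA)
    obtain ⟨ω₂, hω⟩ := path_eq_cons hA hr
    obtain ⟨ω₁, h1, h2⟩ := hh
    rw [hω] at h1 ⊢
    exact hΦ _ _ h1 h2
  induction n, A, hA, y using runs_induction x with
  | self n A hA h =>
    by_cases hxv : x = v
    · subst hxv; exact hv _ _ hA
    · rw [backboneSum_eq_zero]
      · exact zero_le
      · rw [h]
        intro r hr
        rw [List.mem_singleton.1 hr]
        rintro ⟨ω₁, h1, -⟩
        rcases List.suffix_cons_iff.1 h1 with h1 | h1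
        · exact hxv (List.cons.inj h1).1.symm
        · simp at h1
  | stuck n A hA y _ _ h => rw [backboneSum, h]; simp
  | step n A hA y y' _ hyx he h ih1 ih2 =>
    by_cases hyv : y = v
    · subst hyv
      exact hv _ _ (by rw [Finset.card_insert_of_notMem he]; omega)
    rw [backboneSum_step he hA h, part_insert he, ends_add_bd, mul_add]
    have : (fun ω => Hits v Φ (y :: ω)) = Hits v Φ := by
      funext ω
      simp only [Hits, List.suffix_cons_iff, List.cons.injEq, Ne.symm hyv, false_and, false_or]
    rw [this]
    calc _ ≤ (1 + q s(y, y')) * (κ * part s q A (ends y v)) +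
          s s(y, y') * (κ * part s q A (ends y' v)) := by gcongr
      _ = _ := by ring

/-- The two-point function with the first step singled out. -/
noncomputable def stepTwo (t : Sym2 V → ℝ≥0∞) (g : V → V → ℝ≥0∞) (y v : V) : ℝ≥0∞ :=
  ∑' a, t s(y, a) * g a v

theorem backboneSum_hits_tail_le {t : Sym2 V → ℝ≥0∞} (hst : ∀ e, s e = t e * (1 + q e))
    {g : V → V → ℝ≥0∞} (hg : ∀ A x y, part s q A (ends x y) ≤ g x y * part s q A 0)
    {v : V} {Φ : List V → Prop} {κ : ℝ≥0∞}
    (hκ : ∀ n A, A.card ≤ n → backboneSum s q x n A v Φ ≤ κ * part s q A 0)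
    (hΦ : ∀ ω₁ ω₂, (v :: ω₁) <:+ (v :: ω₂) → Φ (v :: ω₁) → Φ (v :: ω₂)) (hA : A.card ≤ n) :
    backboneSum s q x n A y (fun ω => Hits v Φ ω.tail) ≤
      κ * stepTwo t g y v * part s q A 0 := by
  classical
  suffices H : backboneSum s q x n A y (fun ω => Hits v Φ ω.tail) ≤
      κ * (∑' a, if s(y, a) ∈ A then t s(y, a) * g a v else 0) * part s q A 0 by
    refine H.trans ?_
    gcongr
    refine ENNReal.tsum_le_tsum fun a => ?_
    split_ifs <;> simp
  induction n, A, hA, y using runs_induction x with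
  | self n A hA h =>
    rw [backboneSum_eq_zero]
    · exact zero_le
    · rw [h]
      intro r hr
      rw [List.mem_singleton.1 hr]
      rintro ⟨ω₁, h1, -⟩
      simp at h1
  | stuck n A hA y _ _ h => rw [backboneSum, h]; simp
  | step n A hA y y' _ hyx he h ih1 _ =>
    rw [backboneSum_step he hA h]
    set W := ∑' a, if s(y, a) ∈ A then t s(y, a) * g a v else 0
    have hW : W + t s(y, y') * g y' v ≤
        ∑' a, if s(y, a) ∈ insert s(y, y') A then t s(y, a) * g a v else 0 := by
      have h1 : t s(y, y') * g y' v = ∑' a, if a = y' then t s(y, a) * g a v else 0 := by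
        rw [tsum_ite_eq]
      rw [h1, ← ENNReal.tsum_add]
      refine ENNReal.tsum_le_tsum fun a => ?_
      by_cases ha : a = y'
      · subst ha; simp [he]
      · simp only [ha, if_false, add_zero]
        split_ifs with h2 h3
        · exact le_rfl
        · exact absurd (Finset.mem_insert_of_mem h2) h3
        · exact zero_le
        · exact le_rfl
    have hp : (1 + q s(y, y')) * part s q A 0 ≤ part s q (insert s(y, y') A) 0 := by
      rw [part_insert he]; exact le_add_right le_rfl
    have h2 : backboneSum s q x n A y' (Hits v Φ) ≤ κ * (g y' v * part s q A 0) :=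
      (backboneSum_hits_le hκ hΦ hA).trans (by gcongr; exact hg _ _ _)
    calc _ ≤ (1 + q s(y, y')) * (κ * W * part s q A 0) +
          s s(y, y') * (κ * (g y' v * part s q A 0)) := by gcongr; exact h2
      _ = κ * (W + t s(y, y') * g y' v) * ((1 + q s(y, y')) * part s q A 0) := by
        rw [hst]; ring
      _ ≤ _ := by gcongr

/-- The list `ω` passes through the pairs `(v, u)` in `l` in order and then through `x`, with a
positive number of steps before each `v` and before `x`. -/
def Marks (x : V) : List (V × V) → List V → Prop
  | [], ω => Hits x (fun _ => True) ω.tail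
  | p :: l, ω => Hits p.1 (Hits p.2 (Marks x l)) ω.tail

theorem Hits.mono {v : V} {Φ : List V → Prop} {ω₁ ω₂ : List V} (h : ω₁ <:+ ω₂)
    (h' : Hits v Φ ω₁) : Hits v Φ ω₂ := by
  obtain ⟨ω, h1, h2⟩ := h'
  exact ⟨ω, h1.trans h, h2⟩

theorem Marks.mono {l : List (V × V)} {v : V} {ω₁ ω₂ : List V}
    (h : (v :: ω₁) <:+ (v :: ω₂)) (h' : Marks x l (v :: ω₁)) : Marks x l (v :: ω₂) := by
  have h2 : ω₁ <:+ ω₂ := by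
    rcases List.suffix_cons_iff.1 h with h | h
    · rw [(List.cons.inj h).2]
    · exact (List.suffix_cons _ _).trans h
  cases l with
  | nil => exact Hits.mono h2 h'
  | cons p l => exact Hits.mono h2 h'

/-- The weight of the backbone segments between the marks. -/
noncomputable def segments (t : Sym2 V → ℝ≥0∞) (g : V → V → ℝ≥0∞) (x : V) :
    V → List (V × V) → ℝ≥0∞
  | y, [] => stepTwo t g y x
  | y, p :: l => stepTwo t g y p.1 * g p.1 p.2 * segments t g x p.2 l

theorem backboneSum_true : backboneSum s q x n A x (fun _ => True) = part s q A 0 := by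
  rw [backboneSum, runs_self]; simp

theorem backboneSum_marks_le {t : Sym2 V → ℝ≥0∞} (hst : ∀ e, s e = t e * (1 + q e))
    {g : V → V → ℝ≥0∞} (hg : ∀ A x y, part s q A (ends x y) ≤ g x y * part s q A 0)
    (l : List (V × V)) (hA : A.card ≤ n) :
    backboneSum s q x n A y (Marks x l) ≤ segments t g x y l * part s q A 0 := by
  induction l generalizing n A y with
  | nil =>
    refine (backboneSum_hits_tail_le hst hg (κ := 1) (fun n A _ => ?_) (fun _ _ _ _ => trivial)
      hA).trans_eq ?_
    · rw [backboneSum_true, one_mul]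
    · rw [one_mul]; rfl
  | cons p l ih =>
    have h1 : ∀ n A, A.card ≤ n → backboneSum s q x n A p.1 (Hits p.2 (Marks x l)) ≤
        segments t g x p.2 l * g p.1 p.2 * part s q A 0 := by
      intro n A hA
      refine (backboneSum_hits_le (fun n A hA => ih hA) (fun _ _ h => Marks.mono h) hA).trans ?_
      rw [mul_assoc]
      gcongr
      exact hg _ _ _
    refine (backboneSum_hits_tail_le hst hg h1 (fun _ _ h => Hits.mono h) hA).trans_eq ?_
    rw [segments]; ring

theorem part_ends_le_stepTwo {t : Sym2 V → ℝ≥0∞} (hst : ∀ e, s e = t e * (1 + q e))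
    {g : V → V → ℝ≥0∞} (hg : ∀ A x y, part s q A (ends x y) ≤ g x y * part s q A 0)
    (hyx : y ≠ x) (A : Finset (Sym2 V)) :
    part s q A (ends y x) ≤ stepTwo t g y x * part s q A 0 := by
  refine le_trans ?_ (backboneSum_marks_le hst hg [] le_rfl)
  rw [part, cur_ends_eq_sum_runs le_rfl, backboneSum]
  refine List.sum_le_sum fun r hr => ?_
  have hm : Marks x [] r.path := by
    obtain ⟨T, ω, h1, h2, h3, -⟩ := exists_path_of_mem_runs le_rfl r hr
    rcases Nat.eq_zero_or_pos T with rfl | hT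
    · exact absurd (h2.symm.trans h3) hyx
    · refine ⟨[], ?_, trivial⟩
      rw [h1, List.range_succ, List.map_append, List.map_singleton, h3,
        List.tail_append_of_ne_nil]
      · exact List.suffix_append _ _
      · simp; omega
  rw [if_pos hm, mul_one, Finset.prod_one_add, mul_assoc, Finset.sum_mul]
  rfl

end RandomCurrent

namespace RandomCurrent

variable {V : Type*} [DecidableEq V]

/-- A bypass of the part of the backbone between the times `start` and `finish`, along a current
cluster that contains `a` and `b`. -/
structure Interval (V : Type*) where
  start : ℕ
  finish : ℕ
  a : V
  b : V

variable (ω : ℕ → V) (T : ℕ) (R S : Finset (Sym2 V))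

/-- The end points of a bypass are on the backbone or joined to it by an explored even edge; at the
final time the latter is excluded. -/
structure Interval.Valid (I : Interval V) : Prop where
  start_le : I.start ≤ T
  finish_le : I.finish ≤ T
  near_a : I.a = ω I.start ∨ s(ω I.start, I.a) ∈ R
  near_b : I.b = ω I.finish ∨ I.finish < T ∧ s(ω I.finish, I.b) ∈ R
  linked : Linked S I.a I.b

variable {ω T R S}

theorem exists_interval {P : Finset (Sym2 V)}
    (hP : ∀ e ∈ P, ∃ m < T, e = s(ω m, ω (m + 1))) (hR : ∀ e ∈ R, ∃ m < T, ω m ∈ e)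
    (hc : ∀ e, Linked ((P ∪ R ∪ S).erase e) (ω 0) (ω T)) {k : ℕ} (hk : k < T) :
    ∃ I : Interval V, I.Valid ω T R S ∧ I.start ≤ k ∧ k < I.finish := by
  by_contra hno
  have main : ∀ v, Linked ((P ∪ R ∪ S).erase s(ω k, ω (k + 1))) (ω 0) v →
      ∃ m ≤ k, ∃ a, (a = ω m ∨ s(ω m, a) ∈ R) ∧ Linked S a v := by
    intro v hv
    induction hv with
    | refl => exact ⟨0, Nat.zero_le _, ω 0, Or.inl rfl, Linked.refl _ _⟩
    | @tail b c _ hbc ih =>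
      obtain ⟨m, hm, a, ha, hl⟩ := ih
      have hb : ∀ j ≤ T, k < j → b ≠ ω j := by
        rintro j hj hkj rfl
        exact hno ⟨⟨m, j, a, ω j⟩, ⟨by simp only; omega, hj, ha, Or.inl rfl, hl⟩, hm, hkj⟩
      obtain ⟨hne, hbc⟩ := Finset.mem_erase.1 hbc
      rw [Finset.mem_union, Finset.mem_union] at hbc
      rcases hbc with (hbc | hbc) | hbc
      · obtain ⟨j, hj, he⟩ := hP _ hbc
        have hjk : j ≠ k := by rintro rfl; exact hne he
        rcases Sym2.eq_iff.1 he with ⟨rfl, rfl⟩ | ⟨rfl, rfl⟩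
        · have : j < k := by
            by_contra h
            exact hb j hj.le (by omega) rfl
          exact ⟨j + 1, this, _, Or.inl rfl, Linked.refl _ _⟩
        · have : j < k := by
            by_contra h
            exact hb (j + 1) hj (by omega) rfl
          exact ⟨j, this.le, _, Or.inl rfl, Linked.refl _ _⟩
      · obtain ⟨j, hj, he⟩ := hR _ hbc
        rcases Sym2.mem_iff.1 he with rfl | rfl
        · have : j ≤ k := by
            by_contra h
            exact hb j hj.le (by omega) rfl
          exact ⟨j, this, c, Or.inr hbc, Linked.refl _ _⟩
        · by_cases hjk : j ≤ k
          · exact ⟨j, hjk, _, Or.inl rfl, Linked.refl _ _⟩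
          · refine absurd ⟨⟨m, j, a, b⟩, ⟨by simp only; omega, hj.le, ha, Or.inr ⟨hj, ?_⟩, hl⟩, hm,
              not_le.1 hjk⟩ hno
            rwa [Sym2.eq_swap]
      · exact ⟨m, hm, a, ha, Relation.ReflTransGen.tail hl hbc⟩
  obtain ⟨m, hm, a, ha, hl⟩ := main _ (hc s(ω k, ω (k + 1)))
  exact hno ⟨⟨m, T, a, ω T⟩, ⟨by simp only; omega, le_rfl, ha, Or.inl rfl, hl⟩, hm, hk⟩

/-- The bypasses in `l` lead, each starting no later than the previous one stops, from time `p` to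
time `T`. -/
def Chain (T : ℕ) : ℕ → List (Interval V) → Prop
  | p, [] => T ≤ p
  | p, I :: l => I.start ≤ p ∧ Chain T I.finish l

theorem Chain.mono {p p' : ℕ} (h : p ≤ p') {l : List (Interval V)} (hl : Chain T p l) :
    Chain T p' l := by
  cases l with
  | nil => exact le_trans hl h
  | cons I l => exact ⟨hl.1.trans h, hl.2⟩

theorem Chain.of_append {p p' : ℕ} {I I' : Interval V} {l l' : List (Interval V)}
    (hl : Chain T p (l ++ I :: l')) (h : I.finish ≤ I'.finish) (h' : I'.start ≤ p') :
    Chain T p' (I' :: l') := by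
  induction l generalizing p with
  | nil => exact ⟨h', hl.2.mono h⟩
  | cons J l ih => exact ih hl.2

theorem exists_chain {P : Finset (Sym2 V)}
    (hP : ∀ e ∈ P, ∃ m < T, e = s(ω m, ω (m + 1))) (hR : ∀ e ∈ R, ∃ m < T, ω m ∈ e)
    (hc : ∀ e, Linked ((P ∪ R ∪ S).erase e) (ω 0) (ω T)) (p : ℕ) :
    ∃ l : List (Interval V), (∀ I ∈ l, I.Valid ω T R S) ∧ Chain T p l := by
  induction h : T - p using Nat.strong_induction_on generalizing p with
  | _ k ih =>
    by_cases hp : T ≤ p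
    · exact ⟨[], by simp, hp⟩
    · obtain ⟨I, hI, h1, h2⟩ := exists_interval hP hR hc (not_le.1 hp)
      obtain ⟨l, hl, hl'⟩ := ih (T - I.finish) (by omega) I.finish rfl
      exact ⟨I :: l, by simpa using ⟨hI, hl⟩, h1, hl'⟩

/-- The edge that joins `z` to `a`, if they are different. -/
def bridge (z a : V) : List (Sym2 V) := if z = a then [] else [s(z, a)]

theorem mem_bridge {z a : V} {e : Sym2 V} : e ∈ bridge z a ↔ z ≠ a ∧ e = s(z, a) := by
  unfold bridge
  split_ifs with h <;> simp [h]

/-- The explored edges used by a bypass. -/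
def Interval.bridges (ω : ℕ → V) (I : Interval V) : List (Sym2 V) :=
  bridge (ω I.start) I.a ++ bridge (ω I.finish) I.b

/-- The cost of a bypass. -/
def Interval.cost (ω : ℕ → V) (I : Interval V) : ℕ := 3 + (I.bridges ω).length

theorem length_bridge_le (z a : V) : (bridge z a).length ≤ 1 := by
  unfold bridge; split_ifs <;> simp

theorem length_bridge_self (a : V) : (bridge a a).length = 0 := by
  simp [bridge]

theorem length_bridge_of_ne {z a : V} (h : z ≠ a) : (bridge z a).length = 1 := by
  simp [bridge, h]

theorem Interval.cost_eq (I : Interval V) : I.cost ω =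
    3 + ((bridge (ω I.start) I.a).length + (bridge (ω I.finish) I.b).length) := by
  simp [cost, bridges]

/-- A chain of bypasses of minimal cost. -/
structure IsMinimal (ω : ℕ → V) (T : ℕ) (R S : Finset (Sym2 V)) (p : ℕ)
    (l : List (Interval V)) : Prop where
  valid : ∀ I ∈ l, I.Valid ω T R S
  chain : Chain T p l
  le : ∀ l' : List (Interval V), (∀ I ∈ l', I.Valid ω T R S) → Chain T p l' →
    (l.map (Interval.cost ω)).sum ≤ (l'.map (Interval.cost ω)).sum

theorem exists_isMinimal {p : ℕ}
    (h : ∃ l : List (Interval V), (∀ I ∈ l, I.Valid ω T R S) ∧ Chain T p l) :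
    ∃ l, IsMinimal ω T R S p l := by
  classical
  have hex : ∃ c, ∃ l : List (Interval V), ((∀ I ∈ l, I.Valid ω T R S) ∧ Chain T p l) ∧
      (l.map (Interval.cost ω)).sum = c := by
    obtain ⟨l, hl⟩ := h
    exact ⟨_, l, hl, rfl⟩
  obtain ⟨l, hl, hlc⟩ := Nat.find_spec hex
  refine ⟨l, hl.1, hl.2, fun l' h1 h2 => ?_⟩
  rw [hlc]
  exact Nat.find_min' hex ⟨l', ⟨h1, h2⟩, rfl⟩

variable {p : ℕ} {I : Interval V} {l : List (Interval V)}

theorem IsMinimal.tail (h : IsMinimal ω T R S p (I :: l)) : IsMinimal ω T R S I.finish l := by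
  refine ⟨fun J hJ => h.valid J (List.mem_cons_of_mem _ hJ), h.chain.2, fun l' h1 h2 => ?_⟩
  have := h.le (I :: l') (by simpa using ⟨h.valid I List.mem_cons_self, h1⟩) ⟨h.chain.1, h2⟩
  simpa using this

theorem IsMinimal.le_self (h : IsMinimal ω T R S p (I :: l)) {J : Interval V}
    (hJ : J.Valid ω T R S) (h1 : J.start ≤ I.start) (h2 : I.finish ≤ J.finish) :
    I.cost ω ≤ J.cost ω := by
  have := h.le (J :: l)
    (by simpa using ⟨hJ, fun K hK => h.valid K (List.mem_cons_of_mem _ hK)⟩)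
    ⟨h1.trans h.chain.1, h.chain.2.mono h2⟩
  simpa using this

theorem IsMinimal.false_of_merge (h : IsMinimal ω T R S p (I :: l)) {I' J : Interval V}
    (hI' : I' ∈ l) (hJ : J.Valid ω T R S) (h1 : J.start ≤ I.start) (h2 : I'.finish ≤ J.finish) :
    False := by
  obtain ⟨l₁, l₂, rfl⟩ := List.append_of_mem hI'
  have := h.le (J :: l₂)
    (by simpa using ⟨hJ, fun K hK => h.valid K (by simp [hK])⟩)
    (Chain.of_append (l := I :: l₁) h.chain h2 (h1.trans h.chain.1))
  simp only [List.map_cons, List.map_append, List.sum_cons, List.sum_append,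
    Interval.cost_eq] at this
  have e1 := length_bridge_le (ω J.start) J.a
  have e2 := length_bridge_le (ω J.finish) J.b
  omega

theorem IsMinimal.le_of_mem (h : IsMinimal ω T R S p (I :: l)) {I' J : Interval V}
    (hI' : I' ∈ l) (hJ : J.Valid ω T R S) (h1 : J.start ≤ I.finish) (h2 : I'.finish ≤ J.finish) :
    I'.cost ω ≤ J.cost ω := by
  obtain ⟨l₁, l₂, rfl⟩ := List.append_of_mem hI'
  have := h.le (I :: J :: l₂)
    (by simpa using ⟨h.valid I (by simp), hJ, fun K hK => h.valid K (by simp [hK])⟩)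
    ⟨h.chain.1, Chain.of_append (l := l₁) h.chain.2 h2 h1⟩
  simp only [List.map_cons, List.map_append, List.sum_cons, List.sum_append] at this
  omega

theorem IsMinimal.not_linked (h : IsMinimal ω T R S p (I :: l)) {I' : Interval V} (hI' : I' ∈ l) :
    ¬ Linked S I.a I'.a := by
  intro hl
  have v := h.valid I List.mem_cons_self
  have v' := h.valid I' (List.mem_cons_of_mem _ hI')
  exact h.false_of_merge hI' (J := ⟨I.start, I'.finish, I.a, I'.b⟩)
    ⟨v.start_le, v'.finish_le, v.near_a, v'.near_b, hl.trans v'.linked⟩ le_rfl le_rfl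

theorem IsMinimal.nodup_bridges (h : IsMinimal ω T R S p (I :: l)) : (I.bridges ω).Nodup := by
  have v := h.valid I List.mem_cons_self
  have hn : ∀ z a : V, (bridge z a).Nodup := fun z a => by
    unfold bridge; split_ifs <;> simp
  refine List.Nodup.append (hn _ _) (hn _ _) fun e h1 h2 => ?_
  rw [mem_bridge] at h1 h2
  have hlink : Linked S (ω I.start) (ω I.finish) := by
    rcases Sym2.eq_iff.1 (h1.2.symm.trans h2.2) with ⟨e1, e2⟩ | ⟨e1, e2⟩
    · rw [e1]; exact Linked.refl _ _
    · rw [e1, ← e2]; exact v.linked.symm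
  have := h.le_self (J := ⟨I.start, I.finish, ω I.start, ω I.finish⟩)
    ⟨v.start_le, v.finish_le, Or.inl rfl, Or.inl rfl, hlink⟩ le_rfl le_rfl
  simp only [Interval.cost_eq, length_bridge_self, length_bridge_of_ne h1.1] at this
  omega

theorem IsMinimal.disjoint_bridges (h : IsMinimal ω T R S p (I :: l)) {I' : Interval V}
    (hI' : I' ∈ l) : List.Disjoint (I.bridges ω) (I'.bridges ω) := by
  have v := h.valid I List.mem_cons_self
  have v' := h.valid I' (List.mem_cons_of_mem _ hI')
  have hnl := h.not_linked hI'
  intro e h1 h2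
  rw [Interval.bridges, List.mem_append, mem_bridge, mem_bridge] at h1 h2
  rcases h1 with ⟨n1, rfl⟩ | ⟨n1, rfl⟩ <;> rcases h2 with ⟨n2, h2⟩ | ⟨n2, h2⟩ <;>
    rcases Sym2.eq_iff.1 h2 with ⟨e1, e2⟩ | ⟨e1, e2⟩
  · exact hnl (e2 ▸ Linked.refl _ _)
  · exact h.false_of_merge hI' (J := ⟨I.start, I'.finish, ω I.start, I'.b⟩)
      ⟨v.start_le, v'.finish_le, Or.inl rfl, v'.near_b, e1 ▸ v'.linked⟩ le_rfl le_rfl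
  · exact hnl (e2 ▸ v'.linked.symm)
  · exact h.false_of_merge hI' (J := ⟨I.start, I'.finish, I.a, ω I'.finish⟩)
      ⟨v.start_le, v'.finish_le, v.near_a, Or.inl rfl, e2 ▸ Linked.refl _ _⟩ le_rfl le_rfl
  · exact hnl (e2 ▸ v.linked)
  · have := h.le_of_mem hI' (J := ⟨I.finish, I'.finish, ω I.finish, I'.b⟩)
      ⟨v.finish_le, v'.finish_le, Or.inl rfl, v'.near_b, e1 ▸ v'.linked⟩ le_rfl le_rfl
    simp only [Interval.cost_eq, length_bridge_self, length_bridge_of_ne n2] at this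
    omega
  · exact hnl (v.linked.trans (e2 ▸ v'.linked.symm))
  · exact h.false_of_merge hI' (J := ⟨I.start, I'.finish, I.a, ω I'.finish⟩)
      ⟨v.start_le, v'.finish_le, v.near_a, Or.inl rfl, e2 ▸ v.linked⟩ le_rfl le_rfl

theorem Interval.Valid.bridges_subset (h : I.Valid ω T R S) : ∀ e ∈ I.bridges ω, e ∈ R := by
  intro e he
  rw [Interval.bridges, List.mem_append, mem_bridge, mem_bridge] at he
  rcases he with ⟨n, rfl⟩ | ⟨n, rfl⟩
  · exact h.near_a.resolve_left n.symm
  · exact (h.near_b.resolve_left n.symm).2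

theorem IsMinimal.pairwise (h : IsMinimal ω T R S p l) :
    l.Pairwise fun I I' => ¬ Linked S I.a I'.a ∧ List.Disjoint (I.bridges ω) (I'.bridges ω) := by
  induction l generalizing p with
  | nil => exact List.Pairwise.nil
  | cons I l ih =>
    exact List.pairwise_cons.2 ⟨fun I' hI' => ⟨h.not_linked hI', h.disjoint_bridges hI'⟩, ih h.tail⟩

/-! ### The lace read off from a minimal chain -/

/-- A lace is coded by a list of quadruples `(u, v, a, b)`, where the current bypass stops at `u`,
the next one starts at `v`, and `a`, `b` are the end points of the current bypass within its
cluster. These are the explored edges used by a lace that starts at `z`, whose last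
bypass has first cluster point `a`. -/
def laceBridges : V → List (V × V × V × V) → V → List (Sym2 V)
  | z, [], a => bridge z a
  | z, i :: l, a => bridge z i.2.2.1 ++ bridge i.1 i.2.2.2 ++ laceBridges i.2.1 l a

/-- The starting point of the last bypass of a lace. -/
def laceLast : V → List (V × V × V × V) → V
  | z, [] => z
  | _, i :: l => laceLast i.2.1 l

/-- The pairs of points of a lace that are linked within a cluster. -/
def laceLinks (x : V) : List (V × V × V × V) → V → List (V × V)
  | [], a => [(a, x)]
  | i :: l, a => i.2.2 :: laceLinks x l a

/-- The marks left by a lace on the backbone. -/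
def laceMarks (l : List (V × V × V × V)) : List (V × V) := l.map fun i => (i.2.1, i.1)

/-- The lace of a chain of bypasses. -/
def Interval.lace (ω : ℕ → V) : Interval V → List (Interval V) → List (V × V × V × V)
  | _, [] => []
  | I, I' :: l => (ω I.finish, ω I'.start, I.a, I.b) :: lace ω I' l

/-- The first cluster point of the last bypass. -/
def Interval.lastA : Interval V → List (Interval V) → V
  | I, [] => I.a
  | _, I' :: l => lastA I' l

theorem drop_map_range {m : ℕ} (hm : m ≤ T) : ((List.range (T + 1)).map ω).drop m =
    ω m :: ((List.range (T + 1)).map ω).drop (m + 1) := by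
  rw [List.drop_eq_getElem_cons (by simp; omega)]
  simp

theorem hits_drop {Φ : List V → Prop} {m m' : ℕ} (h : m ≤ m') (hm : m' ≤ T)
    (hΦ : Φ (((List.range (T + 1)).map ω).drop m')) :
    Hits (ω m') Φ (((List.range (T + 1)).map ω).drop m) := by
  refine ⟨((List.range (T + 1)).map ω).drop (m' + 1), ?_, ?_⟩
  · rw [← drop_map_range hm]
    obtain ⟨k, rfl⟩ := Nat.exists_eq_add_of_le h
    rw [← List.drop_drop]
    exact List.drop_suffix _ _
  · rwa [← drop_map_range hm]

theorem IsMinimal.lace_spec (hx : ∀ m < T, ω m ≠ ω T) (h : IsMinimal ω T R S p (I :: l)) :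
    p < T ∧ Marks (ω T) (laceMarks (I.lace ω l)) (((List.range (T + 1)).map ω).drop p) ∧
      laceLast (ω I.start) (I.lace ω l) ≠ ω T ∧
      laceBridges (ω I.start) (I.lace ω l) (I.lastA l) =
        (I :: l).flatMap (Interval.bridges ω) ∧
      laceLinks (ω T) (I.lace ω l) (I.lastA l) = (I :: l).map (fun J => (J.a, J.b)) := by
  induction l generalizing p I with
  | nil =>
    have hp : p < T := by
      by_contra hp
      have := h.le [] (by simp) (not_lt.1 hp)
      simp [Interval.cost] at this
    have v := h.valid I List.mem_cons_self
    have hfinish : I.finish = T := le_antisymm v.finish_le h.chain.2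
    have hb : I.b = ω T := by
      rcases v.near_b with hb | hb
      · rw [hb, hfinish]
      · omega
    refine ⟨hp, ?_, hx _ (lt_of_le_of_lt h.chain.1 hp), ?_, ?_⟩
    · show Hits _ _ _
      rw [List.tail_drop]
      exact hits_drop hp le_rfl trivial
    · simp [Interval.lace, laceBridges, Interval.lastA, Interval.bridges, hb, hfinish, bridge]
    · simp [Interval.lace, laceLinks, Interval.lastA, hb]
  | cons I' l ih =>
    have v := h.valid I List.mem_cons_self
    have v' := h.valid I' (by simp)
    obtain ⟨h1, h2, h3, h4, h5⟩ := ih h.tail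
    have hp : p < I'.start := by
      by_contra hp
      have := h.le (I' :: l) (fun J hJ => h.valid J (List.mem_cons_of_mem _ hJ))
        ⟨not_lt.1 hp, h.chain.2.2⟩
      simp [Interval.cost] at this
    refine ⟨hp.trans_le v'.start_le, ?_, h3, ?_, ?_⟩
    · show Hits _ _ _
      rw [List.tail_drop]
      exact hits_drop hp v'.start_le (hits_drop h.chain.2.1 v.finish_le h2)
    · rw [List.flatMap_cons, ← h4]; rfl
    · rw [List.map_cons, ← h5]; rfl

/-- If no edge separates the end points of the backbone, then there is a lace. -/
theorem exists_lace {P : Finset (Sym2 V)}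
    (hP : ∀ e ∈ P, ∃ m < T, e = s(ω m, ω (m + 1))) (hR : ∀ e ∈ R, ∃ m < T, ω m ∈ e)
    (hx : ∀ m < T, ω m ≠ ω T) (hT : 0 < T)
    (hc : ∀ e, Linked ((P ∪ R ∪ S).erase e) (ω 0) (ω T)) :
    ∃ (l : List (V × V × V × V)) (a : V),
      Marks (ω T) (laceMarks l) ((List.range (T + 1)).map ω) ∧ laceLast (ω 0) l ≠ ω T ∧
      (laceBridges (ω 0) l a).Nodup ∧ (∀ e ∈ laceBridges (ω 0) l a, e ∈ R) ∧
      Separate S (laceLinks (ω T) l a) := by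
  obtain ⟨l, hl⟩ := exists_isMinimal (exists_chain hP hR hc 0)
  cases l with
  | nil => exact absurd hl.chain (not_le.2 hT)
  | cons I l =>
    obtain ⟨-, h2, h3, h4, h5⟩ := hl.lace_spec hx
    rw [Nat.le_zero.1 hl.chain.1] at h3 h4
    refine ⟨I.lace ω l, I.lastA l, h2, h3, ?_, ?_, ?_⟩
    · rw [h4, List.nodup_flatMap]
      refine ⟨?_, hl.pairwise.imp fun h => h.2⟩
      have : ∀ (l : List (Interval V)) p, IsMinimal ω T R S p l →
          ∀ J ∈ l, (J.bridges ω).Nodup := by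
        intro l
        induction l with
        | nil => simp
        | cons J l ih =>
          intro p h K hK
          rcases List.mem_cons.1 hK with rfl | hK
          · exact h.nodup_bridges
          · exact ih _ h.tail K hK
      exact this _ _ hl
    · rw [h4]
      intro e he
      obtain ⟨J, hJ, he⟩ := List.mem_flatMap.1 he
      exact (hl.valid J hJ).bridges_subset e he
    · rw [h5]
      refine ⟨?_, ?_⟩
      · intro p hp
        obtain ⟨J, hJ, rfl⟩ := List.mem_map.1 hp
        exact (hl.valid J hJ).linked
      · rw [List.pairwise_map]
        exact hl.pairwise.imp fun h => h.1

end RandomCurrent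

namespace RandomCurrent

variable {V : Type*} [DecidableEq V] {s q t : Sym2 V → ℝ≥0∞}

open scoped Classical in
/-- Independent even edges: the weight of prescribed open edges. -/
theorem sum_powerset_forced_le (hqt : ∀ e, q e ≤ t e ^ 2 * (1 + q e)) {L : List (Sym2 V)}
    (hL : L.Nodup) (E : Finset (Sym2 V)) :
    ∑ R ∈ E.powerset, (∏ e ∈ R, q e) * (if ∀ e ∈ L, e ∈ R then 1 else 0) ≤
      (L.map fun e => t e ^ 2).prod * ∏ e ∈ E, (1 + q e) := by
  induction L generalizing E with
  | nil => simp [Finset.prod_one_add]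
  | cons e L ih =>
    rw [List.nodup_cons] at hL
    by_cases he : e ∈ E
    · obtain ⟨E', he', rfl⟩ : ∃ E', e ∉ E' ∧ insert e E' = E :=
        ⟨E.erase e, Finset.notMem_erase _ _, Finset.insert_erase he⟩
      rw [Finset.sum_powerset_insert he', Finset.prod_insert he', List.map_cons, List.prod_cons]
      have h1 : ∑ R ∈ E'.powerset, (∏ e ∈ R, q e) *
          (if ∀ e' ∈ e :: L, e' ∈ R then (1 : ℝ≥0∞) else 0) = 0 := by
        refine Finset.sum_eq_zero fun R hR => ?_
        rw [if_neg, mul_zero]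
        intro h
        exact he' (Finset.mem_powerset.1 hR (h e List.mem_cons_self))
      rw [h1, zero_add]
      calc _ = q e * ∑ R ∈ E'.powerset, (∏ e ∈ R, q e) *
            (if ∀ e ∈ L, e ∈ R then 1 else 0) := by
            rw [Finset.mul_sum]
            refine Finset.sum_congr rfl fun R hR => ?_
            rw [Finset.prod_insert fun h => he' (Finset.mem_powerset.1 hR h), mul_assoc]
            congr 2
            refine if_congr ?_ rfl rfl
            simp only [List.mem_cons, forall_eq_or_imp, Finset.mem_insert, true_or, true_and]
            refine forall₂_congr fun e' he'' => ?_
            have : e' ≠ e := by rintro rfl; exact hL.1 he''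
            simp [this]
        _ ≤ (t e ^ 2 * (1 + q e)) * ((L.map fun e => t e ^ 2).prod * ∏ e ∈ E', (1 + q e)) := by
            gcongr
            · exact hqt e
            · exact ih hL.2 E'
        _ = _ := by ring
    · rw [Finset.sum_eq_zero]
      · exact zero_le
      · intro R hR
        rw [if_neg, mul_zero]
        intro h
        exact he (Finset.mem_powerset.1 hR (h e List.mem_cons_self))

open scoped Classical in
/-- The diagram of a lace. -/
noncomputable def laceWeight (t : Sym2 V → ℝ≥0∞) (g : V → V → ℝ≥0∞) (x y z : V)
    (l : List (V × V × V × V)) (a : V) : ℝ≥0∞ :=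
  segments t g x y (laceMarks l) * (if laceLast z l = x then 0 else 1) *
    ((laceBridges z l a).map fun e => t e ^ 2).prod *
    ((laceLinks x l a).map fun p => g p.1 p.2 ^ 2).prod

open scoped Classical in
/-- Diagrammatic bound on the currents without an edge separating the sources. -/
theorem cur_doubly_linked_le (hsq : ∀ e, 2 * q e + q e ^ 2 = s e ^ 2) (hs : ∀ e, s e ≠ ∞)
    (hq : ∀ e, q e ≠ ∞) (hst : ∀ e, s e = t e * (1 + q e))
    (hqt : ∀ e, q e ≤ t e ^ 2 * (1 + q e)) {g : V → V → ℝ≥0∞}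
    (hg : ∀ A x y, part s q A (ends x y) ≤ g x y * part s q A 0) {o x : V} (hox : o ≠ x)
    (A : Finset (Sym2 V)) :
    cur s q A (ends o x) (fun S => if ∀ e, Linked (S.erase e) o x then 1 else 0) ≤
      (∑' (l : List (V × V × V × V)) (a : V), laceWeight t g x o o l a) * part s q A 0 := by
  rw [cur_ends_eq_sum_runs le_rfl]
  set F : Finset (Sym2 V) → ℝ≥0∞ := fun S => if ∀ e, Linked (S.erase e) o x then 1 else 0
  have hinner : ∀ r ∈ runs x A.card A o, ∀ R ∈ r.even.powerset,
      cur s q r.rest 0 (fun S => F (r.odd ∪ R ∪ S)) ≤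
      ∑' (l : List (V × V × V × V)) (a : V),
        (if Marks x (laceMarks l) r.path then 1 else 0) *
        (if laceLast o l = x then 0 else 1) *
        (if (laceBridges o l a).Nodup then 1 else 0) *
        (if ∀ e ∈ laceBridges o l a, e ∈ R then 1 else 0) *
        (((laceLinks x l a).map fun p => g p.1 p.2 ^ 2).prod * part s q r.rest 0) := by
    intro r hr R hR
    obtain ⟨T, ω, h1, h2, h3, h4, h5, h6⟩ := exists_path_of_mem_runs le_rfl r hr
    have hT : 0 < T := by
      rcases Nat.eq_zero_or_pos T with rfl | hT
      · exact absurd (h2.symm.trans h3) hox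
      · exact hT
    calc _ ≤ cur s q r.rest 0 (fun S => ∑' (l : List (V × V × V × V)) (a : V),
          (if Marks x (laceMarks l) r.path then 1 else 0) *
          (if laceLast o l = x then 0 else 1) *
          (if (laceBridges o l a).Nodup then 1 else 0) *
          (if ∀ e ∈ laceBridges o l a, e ∈ R then 1 else 0) *
          (if Separate S (laceLinks x l a) then 1 else 0)) := by
          refine cur_mono fun S _ => ?_
          by_cases hF : ∀ e, Linked ((r.odd ∪ R ∪ S).erase e) o x
          · obtain ⟨l, a, g1, g2, g3, g4, g5⟩ := exists_lace (ω := ω) (T := T) (R := R) (S := S) h5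
              (fun e he => h6 e (Finset.mem_powerset.1 hR he)) (by rwa [h3]) hT
              (by rwa [h2, h3])
            rw [h2, h3] at g2
            rw [h3, ← h1] at g1
            rw [h2] at g3 g4
            rw [h3] at g5
            refine le_trans ?_ (ENNReal.le_tsum l)
            refine le_trans ?_ (ENNReal.le_tsum a)
            simp only [F]
            rw [if_pos hF, if_pos g1, if_neg g2, if_pos g3, if_pos g4, if_pos g5]
            simp
          · simp only [F]
            rw [if_neg hF]; exact zero_le
      _ ≤ _ := by
          rw [cur_tsum]
          refine ENNReal.tsum_le_tsum fun l => ?_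
          rw [cur_tsum]
          refine ENNReal.tsum_le_tsum fun a => ?_
          rw [cur_mul_left]
          gcongr
          exact cur_separate_le hsq hs hq hg _ _
  have hrun : ∀ r ∈ runs x A.card A o, (∏ e ∈ r.odd, s e) * ∑ R ∈ r.even.powerset,
      (∏ e ∈ R, q e) * cur s q r.rest 0 (fun S => F (r.odd ∪ R ∪ S)) ≤
      ∑' (l : List (V × V × V × V)) (a : V),
        ((if laceLast o l = x then 0 else 1) *
          ((laceBridges o l a).map fun e => t e ^ 2).prod *
          ((laceLinks x l a).map fun p => g p.1 p.2 ^ 2).prod) *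
        ((∏ e ∈ r.odd, s e) * (∏ e ∈ r.even, (1 + q e)) * part s q r.rest 0 *
          if Marks x (laceMarks l) r.path then 1 else 0) := by
    intro r hr
    calc _ ≤ (∏ e ∈ r.odd, s e) * ∑ R ∈ r.even.powerset, (∏ e ∈ R, q e) *
          ∑' (l : List (V × V × V × V)) (a : V),
        (if Marks x (laceMarks l) r.path then 1 else 0) *
        (if laceLast o l = x then 0 else 1) *
        (if (laceBridges o l a).Nodup then 1 else 0) *
        (if ∀ e ∈ laceBridges o l a, e ∈ R then 1 else 0) *
        (((laceLinks x l a).map fun p => g p.1 p.2 ^ 2).prod * part s q r.rest 0) :=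
          mul_le_mul_right (Finset.sum_le_sum fun R hR =>
            mul_le_mul_right (hinner r hr R hR) _) _
      _ = ∑' (l : List (V × V × V × V)) (a : V), (∏ e ∈ r.odd, s e) * ∑ R ∈ r.even.powerset,
          (∏ e ∈ R, q e) * ((if Marks x (laceMarks l) r.path then 1 else 0) *
        (if laceLast o l = x then 0 else 1) *
        (if (laceBridges o l a).Nodup then 1 else 0) *
        (if ∀ e ∈ laceBridges o l a, e ∈ R then 1 else 0) *
        (((laceLinks x l a).map fun p => g p.1 p.2 ^ 2).prod * part s q r.rest 0)) := by
          simp only [← ENNReal.tsum_mul_left]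
          rw [← Summable.tsum_finsetSum fun _ _ => ENNReal.summable, ← ENNReal.tsum_mul_left]
          refine tsum_congr fun l => ?_
          rw [← Summable.tsum_finsetSum fun _ _ => ENNReal.summable, ← ENNReal.tsum_mul_left]
      _ ≤ _ := by
          refine ENNReal.tsum_le_tsum fun l => ENNReal.tsum_le_tsum fun a => ?_
          by_cases hnd : (laceBridges o l a).Nodup
          · rw [if_pos hnd]
            calc _ = (∏ e ∈ r.odd, s e) * ((if Marks x (laceMarks l) r.path then 1 else 0) *
                  (if laceLast o l = x then 0 else 1) *
                  (((laceLinks x l a).map fun p => g p.1 p.2 ^ 2).prod * part s q r.rest 0)) *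
                  ∑ R ∈ r.even.powerset, (∏ e ∈ R, q e) *
                    (if ∀ e ∈ laceBridges o l a, e ∈ R then 1 else 0) := by
                  rw [Finset.mul_sum, Finset.mul_sum]
                  refine Finset.sum_congr rfl fun R _ => ?_
                  ring
              _ ≤ _ := mul_le_mul_right (sum_powerset_forced_le hqt hnd _) _
              _ = _ := by ring
          · simp [hnd]
  calc _ ≤ _ := List.sum_le_sum hrun
    _ = ∑' (l : List (V × V × V × V)) (a : V),
        ((if laceLast o l = x then 0 else 1) *
          ((laceBridges o l a).map fun e => t e ^ 2).prod *
          ((laceLinks x l a).map fun p => g p.1 p.2 ^ 2).prod) *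
        backboneSum s q x A.card A o (Marks x (laceMarks l)) := by
        have hsum : ∀ {ι : Type _} (L : List (Run V)) (f : ι → Run V → ℝ≥0∞),
            (L.map fun r => ∑' i, f i r).sum = ∑' i, (L.map fun r => f i r).sum := by
          intro ι L f
          induction L with
          | nil => simp
          | cons r L ih => simp only [List.map_cons, List.sum_cons, ENNReal.tsum_add, ih]
        rw [hsum]
        refine tsum_congr fun l => ?_
        rw [hsum]
        refine tsum_congr fun a => ?_
        rw [backboneSum, List.sum_map_mul_left]
    _ ≤ _ := by
        rw [← ENNReal.tsum_mul_right]
        refine ENNReal.tsum_le_tsum fun l => ?_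
        rw [← ENNReal.tsum_mul_right]
        refine ENNReal.tsum_le_tsum fun a => ?_
        calc _ ≤ _ := mul_le_mul_right (backboneSum_marks_le hst hg _ le_rfl) _
          _ = _ := by rw [laceWeight]; ring

end RandomCurrent

namespace RandomCurrent

variable {V : Type*} [DecidableEq V] {s q : Sym2 V → ℝ≥0∞} {A : Finset (Sym2 V)}

theorem ends_comm (x y : V) : ends x y = ends y x := add_comm _ _

theorem bd_map_comp (φ : V ≃ V) (e : Sym2 V) : bd (e.map φ) ∘ φ = bd e := by
  induction e using Sym2.ind with
  | _ u v =>
    funext w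
    simp [Sym2.map_mk, bd_mk, Pi.single_apply]

theorem part_image (φ : V ≃ V) (hs : ∀ e : Sym2 V, s (e.map φ) = s e)
    (hq : ∀ e : Sym2 V, q (e.map φ) = q e) (D : V → ZMod 2) :
    part s q (A.image (Sym2.map φ)) D = part s q A (D ∘ φ) := by
  induction A using Finset.induction_on generalizing D with
  | empty =>
    classical
    rw [Finset.image_empty, part, cur_empty, part, cur_empty]
    refine if_congr ⟨fun h => by rw [h]; rfl, fun h => ?_⟩ rfl rfl
    funext v
    simpa using congrFun h (φ.symm v)
  | insert e A he ih =>
    have he' : e.map φ ∉ A.image (Sym2.map φ) := by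
      rw [Finset.mem_image]
      rintro ⟨e', h1, h2⟩
      exact he (Sym2.map.injective φ.injective h2 ▸ h1)
    rw [Finset.image_insert, part_insert he', part_insert he, ih, ih, hs, hq]
    congr 3
    rw [← bd_map_comp φ e]
    rfl

theorem part_le_part_zero (hsq : ∀ e, 2 * q e + q e ^ 2 = s e ^ 2) (D : V → ZMod 2) :
    part s q A D ≤ part s q A 0 := by
  have h := part_mul_part_le (A := A) hsq D D
  rw [add_self_eq_zero, ← sq, ← sq] at h
  exact (ENNReal.pow_le_pow_left_iff two_ne_zero).1 h

end RandomCurrent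

namespace IsingLace

open RandomCurrent

variable {d : ℕ} (C : Coupling d) (β : ℝ)

open scoped Classical in
/-- The coupling of an edge, set to zero on the diagonal. -/
noncomputable def edgeCoupling (e : Sym2 (Site d)) : ℝ := if e.IsDiag then 0 else β * C.pair e

/-- The weight of an odd edge. -/
noncomputable def oddWeight (e : Sym2 (Site d)) : ℝ≥0∞ :=
  ENNReal.ofReal (Real.sinh (edgeCoupling C β e))

/-- The weight of an edge with positive even current. -/
noncomputable def evenWeight (e : Sym2 (Site d)) : ℝ≥0∞ :=
  ENNReal.ofReal (Real.cosh (edgeCoupling C β e) - 1)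

/-- The hyperbolic tangent of the coupling of an edge. -/
noncomputable def tanhWeight (e : Sym2 (Site d)) : ℝ≥0∞ :=
  ENNReal.ofReal (Real.tanh (edgeCoupling C β e))

variable {C β}

theorem Coupling.pair_nonneg (e : Sym2 (Site d)) : 0 ≤ C.pair e := by
  induction e using Sym2.ind with
  | _ x y => exact C.nonneg _

theorem edgeCoupling_nonneg (hβ : 0 ≤ β) (e : Sym2 (Site d)) : 0 ≤ edgeCoupling C β e := by
  rw [edgeCoupling]
  split_ifs
  · exact le_rfl
  · exact mul_nonneg hβ (Coupling.pair_nonneg e)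

theorem one_add_evenWeight (e : Sym2 (Site d)) :
    1 + evenWeight C β e = ENNReal.ofReal (Real.cosh (edgeCoupling C β e)) := by
  rw [evenWeight, ← ENNReal.ofReal_one, ← ENNReal.ofReal_add zero_le_one]
  · congr 1; ring
  · have := Real.one_le_cosh (edgeCoupling C β e); linarith

theorem two_mul_evenWeight_add (hβ : 0 ≤ β) (e : Sym2 (Site d)) :
    2 * evenWeight C β e + evenWeight C β e ^ 2 = oddWeight C β e ^ 2 := by
  have h1 := Real.one_le_cosh (edgeCoupling C β e)
  have h2 := Real.sinh_nonneg_iff.2 (edgeCoupling_nonneg (C := C) hβ e)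
  have h3 := Real.cosh_sq (edgeCoupling C β e)
  rw [evenWeight, oddWeight, ← ENNReal.ofReal_pow (by linarith), ← ENNReal.ofReal_pow h2,
    show (2 : ℝ≥0∞) = ENNReal.ofReal 2 by simp, ← ENNReal.ofReal_mul (by norm_num),
    ← ENNReal.ofReal_add (by nlinarith) (by positivity)]
  congr 1
  nlinarith

theorem oddWeight_eq (hβ : 0 ≤ β) (e : Sym2 (Site d)) :
    oddWeight C β e = tanhWeight C β e * (1 + evenWeight C β e) := by
  rw [one_add_evenWeight, tanhWeight, oddWeight, ← ENNReal.ofReal_mul, Real.tanh_eq_sinh_div_cosh,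
    div_mul_cancel₀ _ (Real.cosh_pos _).ne']
  rw [Real.tanh_eq_sinh_div_cosh]
  exact div_nonneg (Real.sinh_nonneg_iff.2 (edgeCoupling_nonneg hβ e)) (Real.cosh_pos _).le

theorem evenWeight_le (hβ : 0 ≤ β) (e : Sym2 (Site d)) :
    evenWeight C β e ≤ tanhWeight C β e ^ 2 * (1 + evenWeight C β e) := by
  have h1 := Real.one_le_cosh (edgeCoupling C β e)
  have h2 := Real.sinh_nonneg_iff.2 (edgeCoupling_nonneg (C := C) hβ e)
  have h3 := Real.cosh_sq (edgeCoupling C β e)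
  have h4 : 0 ≤ Real.tanh (edgeCoupling C β e) := by
    rw [Real.tanh_eq_sinh_div_cosh]; positivity
  rw [one_add_evenWeight, tanhWeight, ← ENNReal.ofReal_pow h4,
    ← ENNReal.ofReal_mul (by positivity), evenWeight]
  refine ENNReal.ofReal_le_ofReal ?_
  rw [Real.tanh_eq_sinh_div_cosh, div_pow, div_mul_eq_mul_div, le_div_iff₀ (by positivity)]
  nlinarith

theorem oddWeight_ne_top (e : Sym2 (Site d)) : oddWeight C β e ≠ ∞ := ENNReal.ofReal_ne_top

theorem evenWeight_ne_top (e : Sym2 (Site d)) : evenWeight C β e ≠ ∞ := ENNReal.ofReal_ne_top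

variable (C β) in
/-- The partition function with sources of the Ising model on a set of edges. -/
noncomputable abbrev ipart (A : Finset (Sym2 (Site d))) (D : Site d → ZMod 2) : ℝ≥0∞ :=
  part (oddWeight C β) (evenWeight C β) A D

theorem ipart_ne_top {A : Finset (Sym2 (Site d))} {D : Site d → ZMod 2} : ipart C β A D ≠ ∞ :=
  part_ne_top oddWeight_ne_top evenWeight_ne_top

theorem ipart_zero_ne_zero {A : Finset (Sym2 (Site d))} : ipart C β A 0 ≠ 0 :=
  (zero_lt_one.trans_le one_le_part).ne'

theorem edgeCoupling_map_add (z : Site d) (e : Sym2 (Site d)) :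
    edgeCoupling C β (e.map (Equiv.addRight z)) = edgeCoupling C β e := by
  induction e using Sym2.ind with
  | _ x y =>
    have : C.pair s(x + z, y + z) = C.pair s(x, y) := by
      show C.J (y + z - (x + z)) = C.J (y - x)
      congr 1; abel
    simp [edgeCoupling, this]

theorem ipart_translate (z x y : Site d) (A : Finset (Sym2 (Site d))) :
    ipart C β (A.image (Sym2.map (Equiv.addRight z))) (ends (x + z) (y + z)) =
      ipart C β A (ends x y) := by
  rw [ipart, part_image]
  · congr 1
    funext w
    simp [ends, Pi.single_apply]
  · intro e; rw [oddWeight, edgeCoupling_map_add]; rfl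
  · intro e; rw [evenWeight, edgeCoupling_map_add]; rfl

/-! ### Spin sums -/

/-- The product of the spins over the support of `D`. -/
noncomputable def character (Λ : Finset (Site d)) (f : Site d → ℝ) (D : Site d → ZMod 2) : ℝ :=
  ∏ v ∈ Λ, if D v = 0 then 1 else f v

theorem spin_mul_self {Λ : Finset (Site d)} (φ : Λ → ℤˣ) {v : Site d} (hv : v ∈ Λ) :
    spin φ v * spin φ v = 1 := by
  rw [spin, dif_pos hv]
  rcases Int.units_eq_one_or (φ ⟨v, hv⟩) with h | h <;> simp [h]

theorem character_add_single {Λ : Finset (Site d)} (φ : Λ → ℤˣ) (D : Site d → ZMod 2)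
    {u : Site d} (hu : u ∈ Λ) :
    character Λ (spin φ) (D + Pi.single u 1) = character Λ (spin φ) D * spin φ u := by
  rw [character, character, ← Finset.mul_prod_erase _ _ hu, ← Finset.mul_prod_erase _ _ hu]
  have h1 : ∏ v ∈ Λ.erase u, (if (D + Pi.single u 1 : Site d → ZMod 2) v = 0 then 1 else spin φ v) =
      ∏ v ∈ Λ.erase u, (if D v = 0 then 1 else spin φ v) := by
    refine Finset.prod_congr rfl fun v hv => ?_
    rw [Pi.add_apply, Pi.single_eq_of_ne (Finset.ne_of_mem_erase hv), add_zero]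
  rw [h1, Pi.add_apply, Pi.single_eq_same]
  have h2 : D u = 0 ∨ D u = 1 := by
    generalize D u = a
    revert a; decide
  rcases h2 with h2 | h2
  · simp [h2, mul_comm]
  · have : (1 : ZMod 2) + 1 = 0 := by decide
    simp only [h2, this, if_true, one_ne_zero, if_false, one_mul]
    rw [mul_right_comm, spin_mul_self φ hu, one_mul]

theorem character_zero (Λ : Finset (Site d)) (f : Site d → ℝ) : character Λ f 0 = 1 := by
  simp [character]

theorem character_ends {Λ : Finset (Site d)} (φ : Λ → ℤˣ) {x y : Site d} (hx : x ∈ Λ)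
    (hy : y ∈ Λ) : character Λ (spin φ) (ends x y) = spin φ x * spin φ y := by
  rw [ends, character_add_single φ _ hy, ← zero_add (Pi.single x 1), character_add_single φ _ hx,
    character_zero, one_mul]

theorem character_add_bd {Λ : Finset (Site d)} (φ : Λ → ℤˣ) (D : Site d → ZMod 2)
    {e : Sym2 (Site d)} (he : e ∈ Λ.sym2) :
    character Λ (spin φ) (D + bd e) = character Λ (spin φ) D * (e.map (spin φ)).mul := by
  induction e using Sym2.ind with
  | _ u v =>
    rw [Finset.mk_mem_sym2_iff] at he
    rw [bd_mk, ← add_assoc, character_add_single φ _ he.2, character_add_single φ _ he.1,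
      mul_assoc]
    rfl

theorem sum_character {Λ : Finset (Site d)} {D : Site d → ZMod 2} (hD : ∀ v ∉ Λ, D v = 0)
    [Decidable (D = 0)] :
    ∑ φ : Λ → ℤˣ, character Λ (spin φ) D = if D = 0 then 2 ^ Λ.card else 0 := by
  classical
  have h1 : ∀ φ : Λ → ℤˣ, character Λ (spin φ) D =
      ∏ v : Λ, if D v = 0 then 1 else (((φ v : ℤˣ) : ℤ) : ℝ) := by
    intro φ
    rw [character, ← Finset.prod_coe_sort]
    refine Finset.prod_congr rfl fun v _ => ?_
    rw [spin, dif_pos v.2]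
  simp only [h1]
  have h2 := Finset.prod_univ_sum (fun _ : Λ => (Finset.univ : Finset ℤˣ))
    (fun (v : Λ) (u : ℤˣ) => if D v = 0 then 1 else ((u : ℤ) : ℝ))
  rw [Fintype.piFinset_univ] at h2
  rw [← h2]
  have h3 : ∀ v : Λ, (∑ u : ℤˣ, if D v = 0 then (1 : ℝ) else ((u : ℤ) : ℝ)) =
      if D v = 0 then 2 else 0 := by
    intro v
    split_ifs
    · simp
    · rw [UnitsInt.univ]; simp
  simp only [h3]
  split_ifs with h
  · subst h; simp
  · obtain ⟨v, hv⟩ := Function.ne_iff.1 h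
    have hvΛ : v ∈ Λ := by
      by_contra hn
      exact hv (hD v hn)
    exact Finset.prod_eq_zero (Finset.mem_univ ⟨v, hvΛ⟩) (if_neg hv)

theorem sum_character_mul_prod (hβ : 0 ≤ β) {Λ : Finset (Site d)} {A : Finset (Sym2 (Site d))}
    (hA : A ⊆ Λ.sym2) {D : Site d → ZMod 2} (hD : ∀ v ∉ Λ, D v = 0) :
    ∑ φ : Λ → ℤˣ, character Λ (spin φ) D * ∏ e ∈ A, (Real.cosh (edgeCoupling C β e) +
      Real.sinh (edgeCoupling C β e) * (e.map (spin φ)).mul) =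
      2 ^ Λ.card * (ipart C β A D).toReal := by
  classical
  induction A using Finset.induction_on generalizing D with
  | empty =>
    simp only [Finset.prod_empty, mul_one]
    rw [sum_character hD, ipart, part, cur_empty]
    split_ifs <;> simp
  | insert e A he ih =>
    rw [Finset.insert_subset_iff] at hA
    have hD' : ∀ v ∉ Λ, (D + bd e) v = 0 := by
      intro v hv
      rw [Pi.add_apply, hD v hv, bd_apply_of_notMem, add_zero]
      exact fun h => hv (Finset.mem_sym2_iff.1 hA.1 v h)
    have h1 : ∀ φ : Λ → ℤˣ, character Λ (spin φ) D * ∏ e ∈ insert e A,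
        (Real.cosh (edgeCoupling C β e) +
          Real.sinh (edgeCoupling C β e) * (e.map (spin φ)).mul) =
        Real.cosh (edgeCoupling C β e) * (character Λ (spin φ) D * ∏ e ∈ A,
          (Real.cosh (edgeCoupling C β e) +
            Real.sinh (edgeCoupling C β e) * (e.map (spin φ)).mul)) +
        Real.sinh (edgeCoupling C β e) * (character Λ (spin φ) (D + bd e) * ∏ e ∈ A,
          (Real.cosh (edgeCoupling C β e) +
            Real.sinh (edgeCoupling C β e) * (e.map (spin φ)).mul)) := by
      intro φ
      rw [Finset.prod_insert he, character_add_bd φ D hA.1]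
      ring
    simp only [h1]
    rw [Finset.sum_add_distrib, ← Finset.mul_sum, ← Finset.mul_sum, ih hA.2 hD, ih hA.2 hD',
      ipart, ipart, ipart, part_insert he, one_add_evenWeight, oddWeight, ENNReal.toReal_add,
      ENNReal.toReal_mul, ENNReal.toReal_mul, ENNReal.toReal_ofReal (Real.cosh_pos _).le,
      ENNReal.toReal_ofReal (Real.sinh_nonneg_iff.2 (edgeCoupling_nonneg hβ e))]
    · ring
    · exact ENNReal.mul_ne_top ENNReal.ofReal_ne_top ipart_ne_top
    · exact ENNReal.mul_ne_top ENNReal.ofReal_ne_top ipart_ne_top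

theorem exp_neg_hamiltonian (Λ : Finset (Site d)) (φ : Λ → ℤˣ) :
    Real.exp (-β * hamiltonian C Λ φ) = ∏ e ∈ Λ.sym2, (Real.cosh (edgeCoupling C β e) +
      Real.sinh (edgeCoupling C β e) * (e.map (spin φ)).mul) := by
  classical
  rw [hamiltonian, neg_mul_neg, Finset.mul_sum, Real.exp_sum, Finset.prod_filter]
  refine Finset.prod_congr rfl fun e he => ?_
  by_cases hd : e.IsDiag
  · simp [edgeCoupling, hd]
  · rw [if_pos hd, edgeCoupling, if_neg hd]
    have hm : (e.map (spin φ)).mul = 1 ∨ (e.map (spin φ)).mul = -1 := by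
      rw [← mul_self_eq_one_iff]
      induction e using Sym2.ind with
      | _ u v =>
        rw [Finset.mk_mem_sym2_iff] at he
        show spin φ u * spin φ v * (spin φ u * spin φ v) = 1
        rw [mul_mul_mul_comm, spin_mul_self φ he.1, spin_mul_self φ he.2, one_mul]
    rcases hm with hm | hm
    · rw [hm, mul_one, mul_one, Real.cosh_add_sinh]
    · rw [hm, mul_neg_one, mul_neg_one, mul_neg, ← Real.cosh_sub_sinh, sub_eq_add_neg]

theorem twoPoint_eq (hβ : 0 ≤ β) {Λ : Finset (Site d)} {x y : Site d} (hx : x ∈ Λ) (hy : y ∈ Λ) :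
    twoPoint C β Λ x y =
      (ipart C β Λ.sym2 (ends x y)).toReal / (ipart C β Λ.sym2 0).toReal := by
  have h1 := sum_character_mul_prod (C := C) hβ (Finset.Subset.refl Λ.sym2) (D := ends x y) (by
    intro v hv
    have h1 : v ≠ x := by rintro rfl; exact hv hx
    have h2 : v ≠ y := by rintro rfl; exact hv hy
    rw [ends, Pi.add_apply, Pi.single_eq_of_ne h1, Pi.single_eq_of_ne h2, add_zero])
  have h2 := sum_character_mul_prod (C := C) hβ (Finset.Subset.refl Λ.sym2) (D := 0)
    (fun _ _ => rfl)
  simp only [← exp_neg_hamiltonian, character_ends _ hx hy, character_zero, one_mul] at h1 h2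
  rw [twoPoint, h1, h2, mul_div_mul_left _ _ (by positivity)]

theorem ofReal_twoPoint_mul (hβ : 0 ≤ β) {Λ : Finset (Site d)} {x y : Site d} (hx : x ∈ Λ)
    (hy : y ∈ Λ) : ENNReal.ofReal (twoPoint C β Λ x y) * ipart C β Λ.sym2 0 =
      ipart C β Λ.sym2 (ends x y) := by
  rw [twoPoint_eq hβ hx hy, ENNReal.ofReal_div_of_pos
    (ENNReal.toReal_pos ipart_zero_ne_zero ipart_ne_top), ENNReal.ofReal_toReal ipart_ne_top,
    ENNReal.ofReal_toReal ipart_ne_top, ENNReal.div_mul_cancel ipart_zero_ne_zero ipart_ne_top]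

theorem twoPoint_nonneg (hβ : 0 ≤ β) {Λ : Finset (Site d)} {x y : Site d} (hx : x ∈ Λ)
    (hy : y ∈ Λ) : 0 ≤ twoPoint C β Λ x y := by
  rw [twoPoint_eq hβ hx hy]; positivity

theorem twoPoint_le_of_ipart_le (hβ : 0 ≤ β) {Λ : Finset (Site d)} {x y : Site d} (hx : x ∈ Λ)
    (hy : y ∈ Λ) {c : ℝ} (hc : 0 ≤ c)
    (h : ipart C β Λ.sym2 (ends x y) ≤ ENNReal.ofReal c * ipart C β Λ.sym2 0) :
    twoPoint C β Λ x y ≤ c := by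
  rw [← ofReal_twoPoint_mul hβ hx hy,
    ENNReal.mul_le_mul_iff_left ipart_zero_ne_zero ipart_ne_top] at h
  exact (ENNReal.ofReal_le_ofReal_iff hc).1 h

theorem twoPoint_le_one (hβ : 0 ≤ β) {Λ : Finset (Site d)} {x y : Site d} (hx : x ∈ Λ)
    (hy : y ∈ Λ) : twoPoint C β Λ x y ≤ 1 := by
  refine twoPoint_le_of_ipart_le hβ hx hy zero_le_one ?_
  rw [ENNReal.ofReal_one, one_mul]
  exact part_le_part_zero (two_mul_evenWeight_add hβ) _

theorem twoPoint_of_notMem {Λ : Finset (Site d)} {x : Site d} (h : ¬ (0 ∈ Λ ∧ x ∈ Λ)) :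
    twoPoint C β Λ 0 x = 0 := by
  have : ∀ φ : Λ → ℤˣ, spin φ 0 * spin φ x = 0 := by
    intro φ
    rcases not_and_or.1 h with h | h
    · rw [spin, dif_neg h, zero_mul]
    · rw [mul_comm, spin, dif_neg h, zero_mul]
  simp [twoPoint, this]

theorem twoPoint_mono (hβ : 0 ≤ β) (x : Site d) : Monotone fun Λ => twoPoint C β Λ 0 x := by
  intro Λ Λ' hΛ
  by_cases h : 0 ∈ Λ ∧ x ∈ Λ
  · refine twoPoint_le_of_ipart_le hβ h.1 h.2 (twoPoint_nonneg hβ (hΛ h.1) (hΛ h.2)) ?_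
    rw [← ENNReal.mul_le_mul_iff_left (ipart_zero_ne_zero (A := Λ'.sym2)) ipart_ne_top]
    refine (part_mono_ratio (two_mul_evenWeight_add hβ) oddWeight_ne_top evenWeight_ne_top
      (Finset.sym2_mono hΛ) _).trans_eq ?_
    rw [mul_right_comm, ofReal_twoPoint_mul hβ (hΛ h.1) (hΛ h.2)]
  · simp only [twoPoint_of_notMem h]
    by_cases h' : 0 ∈ Λ' ∧ x ∈ Λ'
    · exact twoPoint_nonneg hβ h'.1 h'.2
    · rw [twoPoint_of_notMem h']

theorem bddAbove_twoPoint (hβ : 0 ≤ β) (x : Site d) :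
    BddAbove (Set.range fun Λ => twoPoint C β Λ 0 x) := by
  refine ⟨1, ?_⟩
  rintro _ ⟨Λ, rfl⟩
  by_cases h : 0 ∈ Λ ∧ x ∈ Λ
  · exact twoPoint_le_one hβ h.1 h.2
  · simp only [twoPoint_of_notMem h]; exact zero_le_one

theorem G_eq_iSup (hβ : 0 ≤ β) (x : Site d) : G C β x = ⨆ Λ, twoPoint C β Λ 0 x :=
  (tendsto_atTop_ciSup (twoPoint_mono hβ x) (bddAbove_twoPoint hβ x)).limUnder_eq

theorem twoPoint_le_G (hβ : 0 ≤ β) (Λ : Finset (Site d)) (x : Site d) :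
    twoPoint C β Λ 0 x ≤ G C β x := by
  rw [G_eq_iSup hβ]
  exact le_ciSup (bddAbove_twoPoint hβ x) Λ

/-- Bounds on the sourced partition functions carry over to the infinite-volume limit. -/
theorem GE_le (hβ : 0 ≤ β) {x : Site d} {c : ℝ≥0∞}
    (h : ∀ A, ipart C β A (ends 0 x) ≤ c * ipart C β A 0) : GE C β x ≤ c := by
  by_cases hc : c = ∞
  · rw [hc]; exact le_top
  rw [GE, ← ENNReal.ofReal_toReal hc]
  refine ENNReal.ofReal_le_ofReal ?_
  rw [G_eq_iSup hβ]
  refine ciSup_le fun Λ => ?_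
  by_cases hΛ : 0 ∈ Λ ∧ x ∈ Λ
  · refine twoPoint_le_of_ipart_le hβ hΛ.1 hΛ.2 ENNReal.toReal_nonneg ?_
    rw [ENNReal.ofReal_toReal hc]
    exact h _
  · rw [twoPoint_of_notMem hΛ]; exact ENNReal.toReal_nonneg

theorem ipart_ends_le (hβ : 0 ≤ β) (A : Finset (Sym2 (Site d))) (x y : Site d) :
    ipart C β A (ends x y) ≤ GE C β (y - x) * ipart C β A 0 := by
  classical
  suffices H : ∀ (A : Finset (Sym2 (Site d))) (y : Site d),
      ipart C β A (ends 0 y) ≤ GE C β y * ipart C β A 0 by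
    have h := H (A.image (Sym2.map (Equiv.addRight (-x)))) (y - x)
    have h1 := ipart_translate (C := C) (β := β) (-x) x y A
    have h2 := ipart_translate (C := C) (β := β) (-x) x x A
    rw [add_neg_cancel, ← sub_eq_add_neg] at h1
    rw [ends_self, ends_self] at h2
    rwa [h1, h2] at h
  clear x y A
  intro A y
  obtain ⟨Λ, hA, h0, hy⟩ : ∃ Λ : Finset (Site d), A ⊆ Λ.sym2 ∧ 0 ∈ Λ ∧ y ∈ Λ := by
    refine ⟨insert 0 (insert y (A.biUnion Sym2.toFinset)), ?_, by simp, by simp⟩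
    intro e he
    rw [Finset.mem_sym2_iff]
    intro v hv
    refine Finset.mem_insert_of_mem (Finset.mem_insert_of_mem ?_)
    exact Finset.mem_biUnion.2 ⟨e, he, Sym2.mem_toFinset.2 hv⟩
  rw [← ENNReal.mul_le_mul_iff_left (ipart_zero_ne_zero (A := Λ.sym2)) ipart_ne_top]
  refine (part_mono_ratio (two_mul_evenWeight_add hβ) oddWeight_ne_top evenWeight_ne_top
    hA _).trans ?_
  rw [mul_right_comm]
  gcongr
  rw [← ipart, ← ofReal_twoPoint_mul hβ h0 hy]
  gcongr
  exact ENNReal.ofReal_le_ofReal (twoPoint_le_G hβ Λ y)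

theorem GE_neg (hβ : 0 ≤ β) (x : Site d) : GE C β (-x) = GE C β x := by
  have h : ∀ x : Site d, GE C β (-x) ≤ GE C β x := by
    intro x
    refine GE_le hβ fun A => ?_
    have := ipart_ends_le (C := C) hβ A (-x) 0
    rwa [zero_sub, neg_neg, ends_comm] at this
  refine le_antisymm (h x) ?_
  have := h (-x)
  rwa [neg_neg] at this

theorem GE_zero_le (hβ : 0 ≤ β) : GE C β (0 : Site d) ≤ 1 := by
  refine GE_le hβ fun A => ?_
  rw [ends_self, one_mul]

theorem tanhWeight_le (hβ : 0 ≤ β) (y a : Site d) : tanhWeight C β s(y, a) ≤ tau C β (a - y) := by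
  refine ENNReal.ofReal_le_ofReal ?_
  rw [edgeCoupling]
  split_ifs
  · rw [Real.tanh_zero]
    rw [Real.tanh_eq_sinh_div_cosh]
    exact div_nonneg (Real.sinh_nonneg_iff.2 (mul_nonneg hβ (C.nonneg _))) (Real.cosh_pos _).le
  · exact le_rfl

theorem stepTwo_le (hβ : 0 ≤ β) (y v : Site d) :
    stepTwo (tanhWeight C β) (fun x y => GE C β (y - x)) y v ≤ Gt C β (v - y) := by
  rw [stepTwo, Gt, conv, 
    ← (Equiv.subRight y).tsum_eq (fun w => tau C β w * GE C β (v - y - w))]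
  refine ENNReal.tsum_le_tsum fun a => ?_
  rw [Equiv.subRight_apply, sub_sub_sub_cancel_right]
  gcongr
  exact tanhWeight_le hβ y a

theorem GE_le_Gt (hβ : 0 ≤ β) {x : Site d} (hx : x ≠ 0) : GE C β x ≤ Gt C β x := by
  refine GE_le hβ fun A => ?_
  refine (part_ends_le_stepTwo (oddWeight_eq hβ) (ipart_ends_le hβ) hx.symm A).trans ?_
  gcongr
  simpa using stepTwo_le (C := C) hβ 0 x

end IsingLace

namespace RandomCurrent

theorem tsum_pi_prod {ι : Type*} [Fintype ι] (f : ι → ℕ → ℝ≥0∞) :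
    ∑' n : ι → ℕ, ∏ i, f i (n i) = ∏ i, ∑' k, f i k := by
  refine Fintype.induction_empty_option (P := fun ι _ => ∀ f : ι → ℕ → ℝ≥0∞,
    ∑' n : ι → ℕ, ∏ i, f i (n i) = ∏ i, ∑' k, f i k) ?_ ?_ ?_ ι f
  · intro α β _ e ih f
    let := Fintype.ofEquiv β e.symm
    have h := ih (fun i => f (e i))
    rw [Fintype.prod_equiv e _ (fun i => ∑' k, f i k) fun _ => rfl] at h
    rw [← h, ← (Equiv.arrowCongr e (Equiv.refl ℕ)).tsum_eq]
    refine tsum_congr fun n => ?_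
    rw [Fintype.prod_equiv e.symm]
    intro i
    simp
  · intro f; simp
  · intro α _ ih f
    rw [← (Equiv.piOptionEquivProd (β := fun _ : Option α => ℕ)).symm.tsum_eq, ENNReal.tsum_prod',
      Fintype.prod_option, ← ih, ← ENNReal.tsum_mul_right]
    refine tsum_congr fun k => ?_
    rw [← ENNReal.tsum_mul_left]
    refine tsum_congr fun n => ?_
    rw [Fintype.prod_option]
    rfl

variable {V : Type*} [DecidableEq V] {s q : Sym2 V → ℝ≥0∞} {B : Finset (Sym2 V)}

/-- The edges with odd current. -/
def oddEdges (n : B → ℕ) : Finset (Sym2 V) :=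
  (Finset.univ.filter fun b => Odd (n b)).map (Function.Embedding.subtype _)

/-- The edges with positive current. -/
def supportEdges (n : B → ℕ) : Finset (Sym2 V) :=
  (Finset.univ.filter fun b => 0 < n b).map (Function.Embedding.subtype _)

theorem mem_oddEdges {n : B → ℕ} {e : Sym2 V} :
    e ∈ oddEdges n ↔ ∃ h : e ∈ B, Odd (n ⟨e, h⟩) := by
  simp [oddEdges]

theorem mem_supportEdges {n : B → ℕ} {e : Sym2 V} :
    e ∈ supportEdges n ↔ ∃ h : e ∈ B, 0 < n ⟨e, h⟩ := by
  simp [supportEdges]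

/-- The part of the weight function `a` on the class of multiplicities prescribed for the edge `e`
by the odd edges `O` and the support `S`. -/
def classWeight (a : ℕ → ℝ≥0∞) (O S : Finset (Sym2 V)) (e : Sym2 V) (k : ℕ) : ℝ≥0∞ :=
  if e ∈ O then (if Odd k then a k else 0) else
    if e ∈ S then (if Even k ∧ 0 < k then a k else 0) else if k = 0 then a k else 0

theorem classWeight_of_mem {n : B → ℕ} {O S : Finset (Sym2 V)} (hOS : O ⊆ S) (hS : S ⊆ B)
    (a : Sym2 V → ℕ → ℝ≥0∞) :
    ∏ b : B, classWeight (a b) O S b (n b) =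
      if oddEdges n = O ∧ supportEdges n = S then ∏ b : B, a b (n b) else 0 := by
  split_ifs with h
  · obtain ⟨rfl, rfl⟩ := h
    refine Finset.prod_congr rfl fun b _ => ?_
    have h1 : (b : Sym2 V) ∈ oddEdges n ↔ Odd (n b) := by simp [mem_oddEdges]
    have h2 : (b : Sym2 V) ∈ supportEdges n ↔ 0 < n b := by simp [mem_supportEdges]
    simp only [classWeight, h1, h2]
    rcases Nat.even_or_odd (n b) with h | h
    · rw [if_neg (Nat.not_odd_iff_even.2 h)]
      rcases Nat.eq_zero_or_pos (n b) with h0 | h0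
      · simp [h0]
      · simp [h0, h]
    · simp [h]
  · by_contra hne
    rw [← ne_eq, Finset.prod_ne_zero_iff] at hne
    have key : ∀ b : B, (Odd (n b) ↔ (b : Sym2 V) ∈ O) ∧ (0 < n b ↔ (b : Sym2 V) ∈ S) := by
      intro b
      have hb := hne b (Finset.mem_univ b)
      unfold classWeight at hb
      split_ifs at hb with h1 h2 h3 h4 h5 <;> simp only [ne_eq, not_true_eq_false] at hb
      · exact ⟨⟨fun _ => h1, fun _ => h2⟩, ⟨fun _ => hOS h1, fun _ => h2.pos⟩⟩
      · exact ⟨⟨fun h => absurd h4.1 (Nat.not_even_iff_odd.2 h), fun h => absurd h h1⟩,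
          ⟨fun _ => h3, fun _ => h4.2⟩⟩
      · rw [h5]
        exact ⟨⟨fun h => by simp at h, fun h => absurd h h1⟩,
          ⟨fun h => by simp at h, fun h => absurd h h3⟩⟩
    refine h ⟨?_, ?_⟩
    · ext e
      rw [mem_oddEdges]
      exact ⟨fun ⟨he, h⟩ => (key ⟨e, he⟩).1.1 h,
        fun h => ⟨hS (hOS h), (key ⟨e, hS (hOS h)⟩).1.2 h⟩⟩
    · ext e
      rw [mem_supportEdges]
      exact ⟨fun ⟨he, h⟩ => (key ⟨e, he⟩).2.1 h, fun h => ⟨hS h, (key ⟨e, hS h⟩).2.2 h⟩⟩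

theorem tsum_classWeight {a : ℕ → ℝ≥0∞} {O S : Finset (Sym2 V)} {e : Sym2 V}
    (ho : ∑' k, (if Odd k then a k else 0) = s e)
    (he : ∑' k, (if Even k ∧ 0 < k then a k else 0) = q e) (h0 : a 0 = 1) :
    ∑' k, classWeight a O S e k = if e ∈ O then s e else if e ∈ S then q e else 1 := by
  simp only [classWeight]
  split_ifs
  · exact ho
  · exact he
  · rw [tsum_ite_eq, h0]

/-- Summation over integer-valued currents, classified by odd edges and support. -/
theorem tsum_current {a : Sym2 V → ℕ → ℝ≥0∞}
    (ho : ∀ e, ∑' k, (if Odd k then a e k else 0) = s e)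
    (he : ∀ e, ∑' k, (if Even k ∧ 0 < k then a e k else 0) = q e) (h0 : ∀ e, a e 0 = 1)
    (F : Finset (Sym2 V) → Finset (Sym2 V) → ℝ≥0∞) :
    ∑' n : B → ℕ, F (oddEdges n) (supportEdges n) * ∏ b : B, a b (n b) = ex s q B F := by
  have h1 : ∀ n : B → ℕ, F (oddEdges n) (supportEdges n) * ∏ b : B, a b (n b) =
      ∑ S ∈ B.powerset, ∑ O ∈ S.powerset, F O S * ∏ b : B, classWeight (a b) O S b (n b) := by
    intro n
    have hS : supportEdges n ∈ B.powerset := by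
      rw [Finset.mem_powerset]
      intro e he
      exact (mem_supportEdges.1 he).1
    have hO : oddEdges n ∈ (supportEdges n).powerset := by
      rw [Finset.mem_powerset]
      intro e he
      obtain ⟨h, h'⟩ := mem_oddEdges.1 he
      exact mem_supportEdges.2 ⟨h, h'.pos⟩
    rw [Finset.sum_eq_single_of_mem _ hS, Finset.sum_eq_single_of_mem _ hO]
    · rw [classWeight_of_mem (Finset.mem_powerset.1 hO) (Finset.mem_powerset.1 hS),
        if_pos ⟨rfl, rfl⟩]
    · intro O hO' hne
      rw [classWeight_of_mem (Finset.mem_powerset.1 hO') (Finset.mem_powerset.1 hS), if_neg,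
        mul_zero]
      exact fun h => hne h.1.symm
    · intro S hS' hne
      refine Finset.sum_eq_zero fun O hO' => ?_
      rw [classWeight_of_mem (Finset.mem_powerset.1 hO') (Finset.mem_powerset.1 hS'), if_neg,
        mul_zero]
      exact fun h => hne h.2.symm
  simp only [h1]
  rw [Summable.tsum_finsetSum fun _ _ => ENNReal.summable, ex]
  refine Finset.sum_congr rfl fun S hS => ?_
  rw [Summable.tsum_finsetSum fun _ _ => ENNReal.summable]
  refine Finset.sum_congr rfl fun O hO => ?_
  rw [ENNReal.tsum_mul_left, tsum_pi_prod (fun (b : B) k => classWeight (a b) O S b k), mul_comm]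
  congr 1
  simp only [fun b : B => tsum_classWeight (O := O) (S := S) (ho b) (he b) (h0 b)]
  rw [Finset.prod_coe_sort B (fun e => if e ∈ O then s e else if e ∈ S then q e else 1)]
  have h2 : ∀ e, (if e ∈ O then s e else if e ∈ S then q e else 1) =
      (if e ∈ O then s e else 1) * (if e ∈ S \ O then q e else 1) := by
    intro e
    by_cases h : e ∈ O <;> simp [h]
  have h3 : O ⊆ B := (Finset.mem_powerset.1 hO).trans (Finset.mem_powerset.1 hS)
  have h4 : S \ O ⊆ B := Finset.sdiff_subset.trans (Finset.mem_powerset.1 hS)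
  simp only [h2]
  rw [Finset.prod_mul_distrib, Finset.prod_ite_mem, Finset.prod_ite_mem,
    Finset.inter_eq_right.2 h3, Finset.inter_eq_right.2 h4]

theorem tsum_odd_series {κ : ℝ} (hκ : 0 ≤ κ) :
    ∑' k : ℕ, (if Odd k then ENNReal.ofReal (κ ^ k / k.factorial) else 0) =
      ENNReal.ofReal (Real.sinh κ) := by
  rw [← tsum_even_add_odd ENNReal.summable ENNReal.summable]
  simp only [Nat.not_odd_iff_even.2 (even_two_mul _), if_false, tsum_zero, zero_add,
    odd_two_mul_add_one, if_true]
  rw [← ENNReal.ofReal_tsum_of_nonneg (fun n => by positivity) (Real.hasSum_sinh κ).summable,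
    (Real.hasSum_sinh κ).tsum_eq]

theorem tsum_even_series {κ : ℝ} (hκ : 0 ≤ κ) :
    ∑' k : ℕ, (if Even k ∧ 0 < k then ENNReal.ofReal (κ ^ k / k.factorial) else 0) =
      ENNReal.ofReal (Real.cosh κ - 1) := by
  have hc := Real.hasSum_cosh κ
  have h1 : HasSum (fun n : ℕ => κ ^ (2 * (n + 1)) / ((2 * (n + 1)).factorial : ℝ))
      (Real.cosh κ - 1) := by
    have := (hasSum_nat_add_iff' 1).2 hc
    simpa using this
  rw [← tsum_even_add_odd ENNReal.summable ENNReal.summable]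
  simp only [Nat.not_even_iff_odd.2 (odd_two_mul_add_one _), false_and, if_false, tsum_zero,
    add_zero, even_two_mul, true_and]
  rw [tsum_eq_zero_add' ENNReal.summable]
  simp only [mul_zero, lt_irrefl, if_false, zero_add]
  rw [← h1.tsum_eq, ENNReal.ofReal_tsum_of_nonneg (fun n => by positivity) h1.summable]
  refine tsum_congr fun n => ?_
  rw [if_pos (by omega)]

end RandomCurrent

namespace IsingLace

open RandomCurrent

variable {d : ℕ} {C : Coupling d} {β : ℝ}

theorem weight_eq {Λ : Finset (Site d)} (n : bonds C Λ → ℕ) :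
    weight C β n = ∏ b : bonds C Λ,
      ENNReal.ofReal (edgeCoupling C β b ^ n b / (n b).factorial) := by
  refine Finset.prod_congr rfl fun b _ => ?_
  rw [edgeCoupling, if_neg (Finset.mem_filter.1 b.2).2.1]

theorem tsum_weight (hβ : 0 ≤ β) (Λ : Finset (Site d))
    (F : Finset (Sym2 (Site d)) → Finset (Sym2 (Site d)) → ℝ≥0∞) :
    ∑' n : bonds C Λ → ℕ, F (oddEdges n) (supportEdges n) * weight C β n =
      ex (oddWeight C β) (evenWeight C β) (bonds C Λ) F := by
  simp only [weight_eq]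
  exact tsum_current
    (a := fun e k => ENNReal.ofReal (edgeCoupling C β e ^ k / k.factorial))
    (fun e => tsum_odd_series (edgeCoupling_nonneg hβ e))
    (fun e => tsum_even_series (edgeCoupling_nonneg hβ e)) (fun e => by simp) F

theorem mem_sources_iff {Λ : Finset (Site d)} (n : bonds C Λ → ℕ) (v : Site d) :
    v ∈ sources n ↔ bdry (oddEdges n) v = 1 := by
  have h1 : bdry (oddEdges n) v = ∑ b : bonds C Λ, if Odd (n b) then bd (b : Sym2 (Site d)) v
      else 0 := by
    rw [bdry, Finset.sum_apply, oddEdges, Finset.sum_map, Finset.sum_filter]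
    rfl
  rw [sources, Set.mem_ofPred_eq, h1, ← ZMod.natCast_eq_one_iff_odd, Nat.cast_sum]
  have h2 : ∀ b : bonds C Λ, (if Odd (n b) then bd (b : Sym2 (Site d)) v else 0) =
      (((if v ∈ (b : Sym2 (Site d)) then n b else 0 : ℕ)) : ZMod 2) := by
    intro b
    obtain ⟨b, hb⟩ := b
    have hd : ¬ b.IsDiag := (Finset.mem_filter.1 hb).2.1
    generalize n ⟨b, hb⟩ = k
    have hk : ((k : ℕ) : ZMod 2) = if Odd k then 1 else 0 := by
      split_ifs with h
      · exact ZMod.natCast_eq_one_iff_odd.2 h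
      · exact ZMod.natCast_eq_zero_iff_even.2 (Nat.not_odd_iff_even.1 h)
    by_cases hv : v ∈ b
    · have hbv : bd b v = 1 := by
        obtain ⟨w, rfl⟩ := Sym2.mem_iff_exists.1 hv
        have hw : v ≠ w := by simpa using hd
        rw [bd_mk, Pi.add_apply, Pi.single_eq_same, Pi.single_eq_of_ne hw, add_zero]
      simp only [hv, if_true, hbv, hk]
    · simp [hv, bd_apply_of_notMem hv]
  simp only [h2]

theorem zmod_two_ext {D D' : Site d → ZMod 2} (h : ∀ v, D v = 1 ↔ D' v = 1) : D = D' := by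
  funext v
  have := h v
  generalize D v = a at this
  generalize D' v = b at this
  revert a b; decide

theorem sources_eq_empty_iff {Λ : Finset (Site d)} (n : bonds C Λ → ℕ) :
    sources n = ∅ ↔ bdry (oddEdges n) = 0 := by
  rw [Set.eq_empty_iff_forall_notMem]
  simp only [mem_sources_iff]
  constructor
  · intro h
    exact zmod_two_ext fun v => ⟨fun h' => absurd h' (h v), fun h' => by simp at h'⟩
  · intro h v hv
    simp [h] at hv

theorem sources_eq_symmDiff_iff {Λ : Finset (Site d)} (n : bonds C Λ → ℕ) {x : Site d}
    (hx : x ≠ 0) : sources n = symmDiff {0} {x} ↔ bdry (oddEdges n) = ends 0 x := by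
  have h1 : ∀ v : Site d, v ∈ (symmDiff {0} {x} : Set (Site d)) ↔ ends 0 x v = 1 := by
    intro v
    rw [Set.mem_symmDiff, Set.mem_singleton_iff, Set.mem_singleton_iff, ends, Pi.add_apply]
    by_cases h0 : v = 0
    · subst h0
      simp [hx.symm]
    · by_cases h2 : v = x
      · subst h2; simp [hx]
      · simp [h0, h2]
  constructor
  · intro h
    refine zmod_two_ext fun v => ?_
    rw [← mem_sources_iff, h, h1]
  · intro h
    ext v
    rw [mem_sources_iff, h, h1]

theorem Z_eq (hβ : 0 ≤ β) (Λ : Finset (Site d)) :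
    Z C β (bonds C Λ) = ipart C β (bonds C Λ) 0 := by
  classical
  rw [Z, ipart, part, cur, ← tsum_weight hβ]
  refine tsum_congr fun n => ?_
  simp only [sources_eq_empty_iff, ite_mul, one_mul, zero_mul]

theorem linked_erase_of_walk {Λ : Finset (Site d)} {n : bonds C Λ → ℕ} {x y : Site d}
    (p : (currentGraph n).Walk x y) {e : Sym2 (Site d)} (he : e ∉ p.edges) :
    Linked ((supportEdges n).erase e) x y := by
  induction p with
  | nil => exact Linked.refl _ _
  | cons h p ih =>
    rw [SimpleGraph.Walk.edges_cons, List.mem_cons, not_or] at he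
    refine Relation.ReflTransGen.head ?_ (ih he.2)
    exact Finset.mem_erase.2 ⟨Ne.symm he.1, mem_supportEdges.2 h.2⟩

theorem DoublyConnected.linked {Λ : Finset (Site d)} {n : bonds C Λ → ℕ} {x y : Site d}
    (h : DoublyConnected n x y) (e : Sym2 (Site d)) :
    Linked ((supportEdges n).erase e) x y := by
  rcases h with rfl | ⟨p, q, -, -, hd⟩
  · exact Linked.refl _ _
  · by_cases he : e ∈ p.edges
    · exact linked_erase_of_walk q fun h => hd he h
    · exact linked_erase_of_walk p he

open scoped Classical in
theorem pi0_mul_le (hβ : 0 ≤ β) (Λ : Finset (Site d)) {x : Site d} (hx : x ≠ 0) :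
    pi0 C β (bonds C Λ) x * ipart C β (bonds C Λ) 0 ≤
      cur (oddWeight C β) (evenWeight C β) (bonds C Λ) (ends 0 x)
        (fun S => if ∀ e, Linked (S.erase e) 0 x then 1 else 0) := by
  rw [cur, ← tsum_weight hβ, pi0, ← ENNReal.tsum_mul_right, Z_eq hβ]
  refine ENNReal.tsum_le_tsum fun n => ?_
  by_cases h : sources n = symmDiff {0} {x} ∧ DoublyConnected n 0 x
  · rw [if_pos h, if_pos ((sources_eq_symmDiff_iff n hx).1 h.1), if_pos h.2.linked, one_mul,
      ENNReal.div_mul_cancel ipart_zero_ne_zero ipart_ne_top]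
  · rw [if_neg h, zero_mul]; exact zero_le

end IsingLace

namespace RandomCurrent

variable {V : Type*} [DecidableEq V]

theorem tsum_fin_succ {α : Type*} {n : ℕ} (f : (Fin (n + 1) → α) → ℝ≥0∞) :
    ∑' u, f u = ∑' (a : α) (u : Fin n → α), f (Fin.cons a u) := by
  rw [← (Fin.consEquiv fun _ : Fin (n + 1) => α).tsum_eq, ENNReal.tsum_prod']
  rfl

theorem tsum_list {α : Type*} (f : List α → ℝ≥0∞) :
    ∑' l, f l = ∑' (n : ℕ) (h : Fin n → α), f (List.ofFn h) := by
  rw [← List.equivSigmaTuple.symm.tsum_eq, ENNReal.tsum_sigma']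
  rfl

theorem laceWeight_cons (t : Sym2 V → ℝ≥0∞) (g : V → V → ℝ≥0∞) (x y z : V)
    (u v a b : V) (l : List (V × V × V × V)) (c : V) :
    laceWeight t g x y z ((u, v, a, b) :: l) c = stepTwo t g y v * g v u *
      (((bridge z a).map fun e => t e ^ 2).prod * g a b ^ 2 *
        ((bridge u b).map fun e => t e ^ 2).prod) * laceWeight t g x u v l c := by
  have hl : laceLast z ((u, v, a, b) :: l) = laceLast v l := rfl
  rw [laceWeight, laceWeight]
  by_cases h : laceLast v l = x
  · rw [if_pos h, if_pos (hl.trans h)]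
    simp only [mul_zero, zero_mul]
  · rw [if_neg h, if_neg (hl ▸ h)]
    simp only [laceMarks, List.map_cons, segments, laceBridges, laceLinks, List.map_append,
      List.prod_append, List.prod_cons]
    ring

end RandomCurrent

namespace IsingLace

open RandomCurrent

variable {d : ℕ} {C : Coupling d} {β : ℝ}

theorem bridge_weight_le (hβ : 0 ≤ β) (z a : Site d) :
    ((bridge z a).map fun e => tanhWeight C β e ^ 2).prod ≤ dot C β (a - z) := by
  unfold bridge dot
  split_ifs with h
  · subst h
    simp [delta]
  · simp only [List.map_cons, List.map_nil, List.prod_cons, List.prod_nil, mul_one]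
    refine le_add_left ?_
    gcongr
    exact tanhWeight_le hβ z a

theorem bridge_weight_le' (hβ : 0 ≤ β) (z a : Site d) :
    ((bridge z a).map fun e => tanhWeight C β e ^ 2).prod ≤ dot C β (z - a) := by
  refine le_trans (le_of_eq ?_) (bridge_weight_le hβ a z)
  unfold bridge
  by_cases h : z = a
  · simp [h]
  · simp [h, Ne.symm h, Sym2.eq_swap]

theorem conv_delta (f : Site d → ℝ≥0∞) : conv f delta = f := by
  classical
  funext x
  rw [conv, tsum_eq_single x]
  · simp [delta]
  · intro y hy
    simp [delta, sub_eq_zero, Ne.symm hy]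

theorem chain_one_one (x : Site d) : chain C β 1 1 x = Gt C β x ^ 2 := by
  simp [chain, convPow, conv_delta]

theorem chain_zero_one (x : Site d) : chain C β 0 1 x = delta x + Gt C β x ^ 2 := by
  have : Finset.Icc 0 1 = ({0, 1} : Finset ℕ) := rfl
  simp [chain, this, convPow, conv_delta]

theorem GE_sq_le (hβ : 0 ≤ β) (x : Site d) : GE C β x ^ 2 ≤ chain C β 0 1 x := by
  rw [chain_zero_one]
  by_cases hx : x = 0
  · subst hx
    refine le_add_right ?_
    have := GE_zero_le (C := C) (d := d) hβ
    simpa [delta] using pow_le_one₀ zero_le this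
  · refine le_add_left ?_
    gcongr
    exact GE_le_Gt hβ hx

variable (C β) in
/-- The infinite-volume two-point function as a function of two points. -/
noncomputable abbrev twoG (x y : Site d) : ℝ≥0∞ := GE C β (y - x)

theorem tsum_bypass_le (hβ : 0 ≤ β) (z u : Site d) :
    ∑' (a : Site d) (b : Site d), ((bridge z a).map fun e => tanhWeight C β e ^ 2).prod *
      twoG C β a b ^ 2 * ((bridge u b).map fun e => tanhWeight C β e ^ 2).prod ≤
      conv (conv (dot C β) (chain C β 0 1)) (dot C β) (u - z) := by
  rw [ENNReal.tsum_comm, conv,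
    ← (Equiv.subRight z).tsum_eq (fun y => conv (dot C β) (chain C β 0 1) y *
      dot C β (u - z - y))]
  refine ENNReal.tsum_le_tsum fun b => ?_
  rw [ENNReal.tsum_mul_right, Equiv.subRight_apply, sub_sub_sub_cancel_right, conv,
    ← (Equiv.subRight z).tsum_eq (fun y => dot C β y * chain C β 0 1 (b - z - y))]
  refine mul_le_mul' (ENNReal.tsum_le_tsum fun a => ?_) (bridge_weight_le' hβ u b)
  rw [Equiv.subRight_apply, sub_sub_sub_cancel_right]
  exact mul_le_mul' (bridge_weight_le hβ z a) (GE_sq_le hβ _)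

theorem tsum_sq_le_sq_tsum {ι : Type*} (f : ι → ℝ≥0∞) : ∑' i, f i ^ 2 ≤ (∑' i, f i) ^ 2 := by
  rw [sq, ← ENNReal.tsum_mul_right]
  refine ENNReal.tsum_le_tsum fun i => ?_
  rw [sq]
  gcongr
  exact ENNReal.le_tsum i

theorem tsum_last_bypass_le (hβ : 0 ≤ β) {z x : Site d} (h : z ≠ x) :
    ∑' a : Site d, ((bridge z a).map fun e => tanhWeight C β e ^ 2).prod * twoG C β a x ^ 2 ≤
      2 * chain C β 1 1 (x - z) := by
  classical
  have h1 : ∀ a : Site d, ((bridge z a).map fun e => tanhWeight C β e ^ 2).prod ≤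
      (if a = z then 1 else 0) + tau C β (a - z) ^ 2 := by
    intro a
    refine (bridge_weight_le hβ z a).trans_eq ?_
    rw [dot, delta]
    simp only [sub_eq_zero]
  calc _ ≤ ∑' a : Site d, ((if a = z then twoG C β a x ^ 2 else 0) +
        (tau C β (a - z) * twoG C β a x) ^ 2) := by
        refine ENNReal.tsum_le_tsum fun a => ?_
        refine (mul_le_mul' (h1 a) le_rfl).trans_eq ?_
        rw [add_mul, ite_mul, one_mul, zero_mul, mul_pow]
    _ = GE C β (x - z) ^ 2 + ∑' a : Site d, (tau C β (a - z) * twoG C β a x) ^ 2 := by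
        rw [ENNReal.tsum_add, tsum_ite_eq]
    _ ≤ Gt C β (x - z) ^ 2 + Gt C β (x - z) ^ 2 := by
        gcongr
        · exact GE_le_Gt hβ (sub_ne_zero.2 h.symm)
        · refine (tsum_sq_le_sq_tsum _).trans_eq ?_
          congr 1
          rw [Gt, conv, ← (Equiv.subRight z).tsum_eq (fun w => tau C β w * GE C β (x - z - w))]
          refine tsum_congr fun a => ?_
          rw [Equiv.subRight_apply, sub_sub_sub_cancel_right]
    _ = _ := by rw [chain_one_one, two_mul]

open scoped Classical in
variable (C β) in
/-- The term `Xterm` with arbitrary initial points. -/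
noncomputable def XtermFrom (m i : ℕ) (x y z : Site d) : ℝ≥0∞ :=
  ∑' (u : Fin (i + 1) → Site d) (v : Fin (i + 1) → Site d),
    if u 0 = y ∧ v 0 = z then
      (∏ j : Fin i, U C β m (u j.castSucc) (v j.castSucc) (u j.succ) (v j.succ)) *
        V C β m (u (Fin.last i)) (v (Fin.last i)) x
    else 0

theorem XtermFrom_zero (m : ℕ) (x y z : Site d) : XtermFrom C β m 0 x y z = V C β m y z x := by
  rw [XtermFrom, tsum_fin_succ, tsum_eq_single y]
  · simp only [tsum_fin_succ, Fin.cons_zero, true_and, Finset.univ_eq_empty, Finset.prod_empty,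
      one_mul, Fin.last_zero]
    rw [tsum_eq_single default fun b h => absurd (Subsingleton.elim b default) h, tsum_eq_single z]
    · rw [tsum_eq_single default fun b h => absurd (Subsingleton.elim b default) h]
      simp
    · intro b hb
      simp [hb]
  · intro b hb
    simp [hb]

theorem XtermFrom_succ (m i : ℕ) (x y z : Site d) : XtermFrom C β m (i + 1) x y z =
    ∑' (u : Site d) (v : Site d), U C β m y z u v * XtermFrom C β m i x u v := by
  classical
  have h1 : ∀ (u v : Fin (i + 1) → Site d) (a b : Site d),
      (∏ j : Fin (i + 1), U C β m ((Fin.cons a u : Fin (i + 2) → Site d) j.castSucc)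
        ((Fin.cons b v : Fin (i + 2) → Site d) j.castSucc)
        ((Fin.cons a u : Fin (i + 2) → Site d) j.succ)
        ((Fin.cons b v : Fin (i + 2) → Site d) j.succ)) =
      U C β m a b (u 0) (v 0) *
        ∏ j : Fin i, U C β m (u j.castSucc) (v j.castSucc) (u j.succ) (v j.succ) := by
    intro u v a b
    rw [Fin.prod_univ_succ]
    simp only [Fin.cons_succ, Fin.castSucc_zero, Fin.cons_zero, Fin.castSucc_succ]
  have hlast : Fin.last (i + 1) = (Fin.last i).succ := rfl
  have h2 : XtermFrom C β m (i + 1) x y z = ∑' (u : Fin (i + 1) → Site d)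
      (v : Fin (i + 1) → Site d), U C β m y z (u 0) (v 0) *
        ((∏ j : Fin i, U C β m (u j.castSucc) (v j.castSucc) (u j.succ) (v j.succ)) *
          V C β m (u (Fin.last i)) (v (Fin.last i)) x) := by
    rw [XtermFrom, tsum_fin_succ, tsum_eq_single y]
    · refine tsum_congr fun u => ?_
      rw [tsum_fin_succ, tsum_eq_single z]
      · refine tsum_congr fun v => ?_
        rw [h1, hlast]
        simp only [Fin.cons_zero, Fin.cons_succ, and_self, if_true, mul_assoc]
      · intro b hb
        simp [hb]
    · intro b hb
      simp [hb]
  rw [h2]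
  simp only [XtermFrom, ← ENNReal.tsum_mul_left]
  have h3 : ∀ f : Site d → Site d → (Fin (i + 1) → Site d) → (Fin (i + 1) → Site d) → ℝ≥0∞,
      ∑' (a : Site d) (b : Site d) (u : Fin (i + 1) → Site d) (v : Fin (i + 1) → Site d),
        f a b u v =
      ∑' (u : Fin (i + 1) → Site d) (v : Fin (i + 1) → Site d) (a : Site d) (b : Site d),
        f a b u v := by
    intro f
    calc _ = ∑' (a : Site d) (u : Fin (i + 1) → Site d) (b : Site d) (v : Fin (i + 1) → Site d),
          f a b u v := tsum_congr fun a => ENNReal.tsum_comm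
      _ = ∑' (u : Fin (i + 1) → Site d) (a : Site d) (b : Site d) (v : Fin (i + 1) → Site d),
          f a b u v := ENNReal.tsum_comm
      _ = ∑' (u : Fin (i + 1) → Site d) (a : Site d) (v : Fin (i + 1) → Site d) (b : Site d),
          f a b u v := tsum_congr fun u => tsum_congr fun a => ENNReal.tsum_comm
      _ = _ := tsum_congr fun u => ENNReal.tsum_comm
  rw [h3]
  refine tsum_congr fun u => tsum_congr fun v => ?_
  rw [tsum_eq_single (u 0), tsum_eq_single (v 0)]
  · simp
  · intro b hb
    simp [Ne.symm hb]
  · intro a ha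
    simp [Ne.symm ha]

theorem tsum_laceWeight_le (hβ : 0 ≤ β) (x : Site d) (n : ℕ) (y z : Site d) :
    ∑' (h : Fin n → Site d × Site d × Site d × Site d) (c : Site d),
      laceWeight (tanhWeight C β) (twoG C β) x y z (List.ofFn h) c ≤
      2 * XtermFrom C β 1 n x y z := by
  induction n generalizing y z with
  | zero =>
    rw [tsum_eq_single default fun b h => absurd (Subsingleton.elim b default) h, XtermFrom_zero]
    simp only [List.ofFn_zero, laceWeight, laceMarks, List.map_nil, segments, laceLast,
      laceBridges, laceLinks, List.map_cons, List.prod_cons, List.prod_nil, mul_one]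
    by_cases h : z = x
    · simp [h]
    · simp only [h, if_false, mul_one, mul_assoc]
      rw [ENNReal.tsum_mul_left, V, mul_left_comm]
      exact mul_le_mul' (stepTwo_le hβ y x) (tsum_last_bypass_le hβ h)
  | succ n ih =>
    rw [tsum_fin_succ, XtermFrom_succ]
    simp only [List.ofFn_cons]
    rw [ENNReal.tsum_prod', ← ENNReal.tsum_mul_left]
    refine ENNReal.tsum_le_tsum fun u => ?_
    rw [ENNReal.tsum_prod', ← ENNReal.tsum_mul_left]
    refine ENNReal.tsum_le_tsum fun v => ?_
    rw [ENNReal.tsum_prod']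
    simp only [laceWeight_cons, ENNReal.tsum_mul_left, ENNReal.tsum_mul_right]
    rw [U, if_neg one_ne_zero, mul_left_comm]
    refine mul_le_mul' (mul_le_mul' (mul_le_mul' (stepTwo_le hβ y v) ?_) (tsum_bypass_le hβ z u))
      (ih u v)
    rw [twoG, ← GE_neg hβ, neg_sub]

end IsingLace

theorem theorem1 {d : ℕ} (C : IsingLace.Coupling d) (β : ℝ) (hβ : 0 ≤ β)
    (Λ : Finset (IsingLace.Site d)) (h0 : (0 : IsingLace.Site d) ∈ Λ)
    (x : IsingLace.Site d) (hxΛ : x ∈ Λ) (hx : x ≠ 0) :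
    IsingLace.pi0 C β (IsingLace.bonds C Λ) x ≤ 2 * IsingLace.X C β 1 x := by
  open IsingLace RandomCurrent in
  have h1 := (pi0_mul_le (C := C) hβ Λ hx).trans
    (cur_doubly_linked_le (two_mul_evenWeight_add hβ) oddWeight_ne_top evenWeight_ne_top
      (oddWeight_eq hβ) (evenWeight_le hβ) (ipart_ends_le hβ) hx.symm (bonds C Λ))
  rw [ENNReal.mul_le_mul_iff_left IsingLace.ipart_zero_ne_zero IsingLace.ipart_ne_top] at h1
  refine h1.trans ?_
  rw [RandomCurrent.tsum_list, IsingLace.X, ← ENNReal.tsum_mul_left]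
  refine ENNReal.tsum_le_tsum fun n => ?_
  exact IsingLace.tsum_laceWeight_le hβ x n 0 0
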